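/- Let $\gamma>0$ and let $\theta_1,\theta_2,\dots$ be the real numbers with generating function $$\sum_{n\ge1}\theta_n z^n=\frac{\Gamma(\gamma+1)}{(1-z)^{\gamma+1}}-\Gamma(\gamma+1)\qquad(|z|<1),$$ that is, $\theta_n=\Gamma(\gamma+n+1)/n!$ for all $n\ge1$; these satisfy $\theta_n/n^\gamma\to1$. For a permutation $\sigma$ of $\{1,\dots,n\}$, let $R_j(\sigma)$ be the number of cycles of length $j$ (fixed points being cycles of length $1$), $K(\sigma)=\sum_{j=1}^nR_j(\sigma)$ the number of cycles, and $L_1(\sigma)$ the length of the cycle that contains the index $1$. Let $\mathbb P_n$ be the probability measure on the permutations of $\{1,\dots,n\}$ given by $$\mathbb P_n(\sigma)=\frac1{n!\,h_n}\prod_{j\ge1}\theta_j^{R_j(\sigma)},\qquad h_n=\frac1{n!}\sum_{\sigma}\prod_{j\ge1}\theta_j^{R_j(\sigma)},$$ and let $\mathbb E_n$ be its expectation. Then, as $n\to\infty$: (a) $L_1/n^{1/(1+\gamma)}$ converges weakly to the Gamma law with shape $\gamma+1$ and rate $a=\Gamma(\gamma+1)^{1/(\gamma+1)}$. Moreover,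 for all $s\ge0$, $$\lim_{n\to\infty}\mathbb P_n\Bigl(\frac{L_1}{n^{1/(1+\gamma)}}<s\Bigr)=\int_0^s x^\gamma e^{-ax}\,dx.$$ (b) $\displaystyle\lim_{n\to\infty}n^{-\gamma/(\gamma+1)}\,\mathbb E_n(K)=\bigl(\Gamma(\gamma)/\gamma^\gamma\bigr)^{1/(\gamma+1)}$. (c) The joint law of $(R_1,R_2,R_3,\dots)$ on $\mathbb N^{\mathbb N}$ (with the product topology) converges weakly to the law of a sequence of independent Poisson random variables with means $\theta_1,\theta_2/2,\theta_3/3,\dots$. -/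

import Mathlib

open Filter Topology MeasureTheory ProbabilityTheory Asymptotics

namespace WeightedPerm

/-- The number `R_j(σ)` of cycles of length `j` of a permutation `σ` (fixed points are cycles of
length `1`). -/
def cycleCount {n : ℕ} (j : ℕ) (σ : Equiv.Perm (Fin n)) : ℕ :=
  σ.partition.parts.count j

/-- The total number `K(σ)` of cycles of `σ`. -/
def numCycles {n : ℕ} (σ : Equiv.Perm (Fin n)) : ℕ :=
  ∑ j ∈ Finset.Icc 1 n, cycleCount j σ

open scoped Classical in
/-- The length `L_1(σ)` of the cycle that contains the first index (which is `0 : Fin n`);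
the value `0` for the permutation of the empty set is a convention. -/
noncomputable def firstCycleLength : {n : ℕ} → Equiv.Perm (Fin n) → ℕ
  | 0, _ => 0
  | n + 1, σ => (Finset.univ.filter fun i : Fin (n + 1) => σ.SameCycle 0 i).card

/-- The weight `∏_j θ_j ^ R_j(σ)`; the factors with `j > n` are equal to `1`. -/
def weight (θ : ℕ → ℝ) {n : ℕ} (σ : Equiv.Perm (Fin n)) : ℝ :=
  ∏ j ∈ Finset.Icc 1 n, θ j ^ cycleCount j σ

/-- The normalization `h_n = (1 / n!) ∑_σ ∏_j θ_j ^ R_j(σ)`. -/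
noncomputable def partitionFunction (θ : ℕ → ℝ) (n : ℕ) : ℝ :=
  1 / (n.factorial : ℝ) * ∑ σ : Equiv.Perm (Fin n), weight θ σ

/-- Every set of permutations is measurable. -/
instance instMeasurableSpacePerm (n : ℕ) : MeasurableSpace (Equiv.Perm (Fin n)) := ⊤

/-- The measure `ℙ_n` on the permutations of `n` elements that gives to `σ` the mass
`(1 / (n! h_n)) ∏_j θ_j ^ R_j(σ)`. -/
noncomputable def permLaw (θ : ℕ → ℝ) (n : ℕ) : Measure (Equiv.Perm (Fin n)) :=
  ∑ σ : Equiv.Perm (Fin n),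
    ENNReal.ofReal (1 / ((n.factorial : ℝ) * partitionFunction θ n) * weight θ σ) •
      Measure.dirac σ

/-- The parameters `θ_1, θ_2, …` have the generating function
`∑_{n ≥ 1} θ_n z ^ n = Γ(γ + 1) / (1 - z) ^ (γ + 1) - Γ(γ + 1)` on the open unit disc (with the
principal branch of the power). The value `θ 0` plays no role. -/
def HasAlgebraicGenFun (γ : ℝ) (θ : ℕ → ℝ) : Prop :=
  ∀ z : ℂ, ‖z‖ < 1 →
    HasSum (fun n : ℕ => (θ (n + 1) : ℂ) * z ^ (n + 1))
      ((Real.Gamma (γ + 1) : ℂ) / (1 - z) ^ ((γ : ℂ) + 1) - (Real.Gamma (γ + 1) : ℂ))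

end WeightedPerm

/-!
Write `h_n` for the normalization, `N = n ^ (1 / (γ + 1))`, `a = Γ(γ + 1) ^ (1 / (γ + 1))`.
Removing the cycle of the first index gives the recursion `n h_n = ∑_{j ≤ n} θ_j h_{n-j}`
(`mul_partitionFunction`), and the law of the first cycle length has the masses
`θ_j h_{n-j} / (n h_n)` (`integral_firstCycleLength`). All claims therefore depend on the ratios
`h_{n-j} / h_n` for `j` of order `N`, which should be close to `e ^ (-a j / N)`. No saddle point
analysis is needed for them.

* A Cauchy–Binet argument (`logConcave_of_recursion`) shows that a sequence `H` with
  `n H_n = ∑ X_j H_{n-j}` is log-concave if `X_0, X_1, …` is log-concave and `X_0 ≥ 1`. Here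
  `X_0` can be chosen freely, as it does not enter the recursion. With
  `X_j = Γ(γ + j + 1) / j!` this applies to `H = h` for `γ ≥ 1`. For `γ < 1` it applies to the
  partial sums of `h`, whose kernel is `X_j + 1`.
* Log-concavity bounds `H_{n-j} / H_n` by `z ^ j` with `z = H_{n-1} / H_n`, so the recursion gives
  `n ≤ ∑ X_j z ^ j`. The generating function then bounds `1 - z` from above by
  `(a + o(1)) / N`, and this bounds `h_{n-j} / h_n` from below (`eventually_pow_mul_le`).
* Hence the densities of the smoothed law of `L_1 / N` are asymptotically at least
  `x ^ γ e ^ (-a x)`. This is a probability density, so nothing can be lost, and Scheffé's lemma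
  turns the one-sided bound into convergence in `L¹` (`tendsto_sum_firstCycleMass`). The
  limit law of `L_1 / N` follows.
* The expected number of cycles is `n` times the expected inverse of `L_1`. The contribution of
  short cycles to it is uniformly small because `h` is nondecreasing
  (`tendsto_sum_inv_firstCycleMass`).
* For the cycle counts, the events `R_1 = c_1, …, R_m = c_m` are handled one count at a time.
  Inclusion–exclusion writes the event that a count equals `r` through binomial moments. These
  are constants times ratios `h_{n-k} / h_n`, which tend to `1`, and dominated convergence
  produces a Poisson factor (`tendsto_partitionSum_ite`). Cylinder events determine weak
  convergence on `ℕ → ℕ`.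
-/

namespace WeightedPerm

/-! ### Sums over integer partitions -/

/-- The weight `∏_i (θ_i / i) ^ m_i / m_i!` of a partition with `m_i` parts equal to `i`. It is the
total weight of the permutations with these cycle lengths, divided by `n!`. -/
noncomputable def partitionWeight (θ : ℕ → ℝ) {n : ℕ} (p : n.Partition) : ℝ :=
  ∏ i ∈ Finset.Icc 1 n, (θ i / i) ^ p.parts.count i / ((p.parts.count i).factorial : ℝ)

/-- The weighted sum of `φ` over all partitions of `n`, as a function of the multiset of parts. -/
noncomputable def partitionSum (θ : ℕ → ℝ) (n : ℕ) (φ : Multiset ℕ → ℝ) : ℝ :=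
  ∑ p : n.Partition, partitionWeight θ p * φ p.parts

theorem filter_not_two_le_parts {n : ℕ} (p : n.Partition) :
    p.parts.filter (fun i => ¬ 2 ≤ i) = Multiset.replicate (p.parts.count 1) 1 := by
  rw [← Multiset.filter_eq']
  refine Multiset.filter_congr fun i hi => ?_
  have := p.parts_pos hi
  omega

/-- The order of the centralizer of a permutation, written with fixed points counted apart (left)
and as parts equal to `1` (right). -/
theorem prod_centralizer_factors {n : ℕ} (p : n.Partition) :
    (n - (p.parts.filter (2 ≤ ·)).sum).factorial * (p.parts.filter (2 ≤ ·)).prod *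
      (∏ i ∈ (p.parts.filter (2 ≤ ·)).toFinset, ((p.parts.filter (2 ≤ ·)).count i).factorial) =
    ∏ i ∈ Finset.Icc 1 n, i ^ p.parts.count i * (p.parts.count i).factorial := by
  set m := p.parts.filter (2 ≤ ·) with hm
  have hcount : ∀ i, 2 ≤ i → m.count i = p.parts.count i := fun i hi => by
    rw [hm, Multiset.count_filter_of_pos hi]
  have hone := filter_not_two_le_parts p
  have hsum : n - m.sum = p.parts.count 1 := by
    have h1 := congrArg Multiset.sum (Multiset.filter_add_not (2 ≤ ·) p.parts)
    rw [Multiset.sum_add, hone, p.parts_sum, ← hm] at h1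
    simp at h1
    omega
  rw [hsum, Finset.prod_multiset_count, mul_assoc, ← Finset.prod_mul_distrib]
  have hsub : m.toFinset ⊆ Finset.Icc 2 n := fun i hi => by
    rw [Multiset.mem_toFinset, hm, Multiset.mem_filter] at hi
    exact Finset.mem_Icc.2 ⟨hi.2, Nat.Partition.le_of_mem_parts hi.1⟩
  rw [Finset.prod_subset hsub fun i _ hi => by
    rw [Multiset.mem_toFinset, ← Multiset.count_eq_zero] at hi; simp [hi]]
  rcases Nat.eq_zero_or_pos n with rfl | hn
  · simp
  · rw [← Finset.prod_erase_mul _ _ (Finset.mem_Icc.2 ⟨le_rfl, hn⟩ : 1 ∈ Finset.Icc 1 n),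
      mul_comm]
    have : (Finset.Icc 1 n).erase 1 = Finset.Icc 2 n := by ext; simp; omega
    rw [this]
    congr 1
    · refine Finset.prod_congr rfl fun i hi => ?_
      rw [hcount i (Finset.mem_Icc.1 hi).1]
    · simp

open Classical in
/-- **Cauchy's formula** for the number of permutations with given cycle lengths. -/
theorem card_partition_eq {α : Type*} [Fintype α] [DecidableEq α]
    (p : (Fintype.card α).Partition) :
    (Finset.univ.filter fun σ : Equiv.Perm α => σ.partition = p).card *
      (∏ i ∈ Finset.Icc 1 (Fintype.card α), i ^ p.parts.count i * (p.parts.count i).factorial) =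
    (Fintype.card α).factorial := by
  have hfilt : (Finset.univ.filter fun σ : Equiv.Perm α => σ.partition = p) =
      Finset.univ.filter fun σ : Equiv.Perm α => σ.cycleType = p.parts.filter (2 ≤ ·) := by
    refine Finset.filter_congr fun σ _ => ⟨?_, fun h => ?_⟩
    · rintro rfl
      exact Equiv.Perm.filter_parts_partition_eq_cycleType.symm
    · have hone := filter_not_two_le_parts p
      refine Nat.Partition.ext ?_
      have h1 := congrArg Multiset.sum (Multiset.filter_add_not (2 ≤ ·) p.parts)
      rw [Multiset.sum_add, hone, p.parts_sum, ← h, Equiv.Perm.sum_cycleType] at h1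
      simp at h1
      have h2 : Fintype.card α - σ.support.card = p.parts.count 1 := by omega
      rw [Equiv.Perm.parts_partition, h, h2, ← hone, Multiset.filter_add_not]
  rw [hfilt, ← prod_centralizer_factors]
  have := Equiv.Perm.card_of_cycleType_mul_eq α (p.parts.filter (2 ≤ ·))
  rw [if_pos] at this
  · convert this
  · refine ⟨?_, fun a ha => (Multiset.mem_filter.1 ha).2⟩
    have h1 := congrArg Multiset.sum (Multiset.filter_add_not (2 ≤ ·) p.parts)
    rw [Multiset.sum_add, p.parts_sum] at h1
    omega

theorem sum_perm_eq_sum_partition {α : Type*} [Fintype α] [DecidableEq α] {n : ℕ}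
    (hn : n = Fintype.card α) (f : Multiset ℕ → ℝ) :
    ∑ σ : Equiv.Perm α, f σ.partition.parts =
      (n.factorial : ℝ) * ∑ p : n.Partition,
        (∏ i ∈ Finset.Icc 1 n, ((i : ℝ) ^ p.parts.count i * (p.parts.count i).factorial))⁻¹ *
          f p.parts := by
  classical
  subst hn
  rw [← Finset.sum_fiberwise (s := Finset.univ) (g := fun σ : Equiv.Perm α => σ.partition),
    Finset.mul_sum]
  refine Finset.sum_congr rfl fun p _ => ?_
  rw [Finset.sum_congr rfl (g := fun _ => f p.parts) fun σ hσ => by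
    rw [(Finset.mem_filter.1 hσ).2], Finset.sum_const, nsmul_eq_mul, ← mul_assoc]
  congr 1
  have hne : (∏ i ∈ Finset.Icc 1 (Fintype.card α),
      ((i : ℝ) ^ p.parts.count i * (p.parts.count i).factorial)) ≠ 0 := by
    refine Finset.prod_ne_zero_iff.2 fun i hi => ?_
    have : (0 : ℝ) < i := by exact_mod_cast (Finset.mem_Icc.1 hi).1
    positivity
  rw [eq_mul_inv_iff_mul_eq₀ hne]
  exact_mod_cast card_partition_eq p

/-- Sums over permutations of functions of the cycle lengths are sums over partitions. -/
theorem sum_weight_mul (θ : ℕ → ℝ) (n : ℕ) (φ : Multiset ℕ → ℝ) :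
    ∑ σ : Equiv.Perm (Fin n), weight θ σ * φ σ.partition.parts =
      (n.factorial : ℝ) * partitionSum θ n φ := by
  have := sum_perm_eq_sum_partition (α := Fin n) (n := n) (by simp)
    (fun s => (∏ j ∈ Finset.Icc 1 n, θ j ^ s.count j) * φ s)
  simp only [weight, cycleCount]
  rw [this, partitionSum]
  congr 1
  refine Finset.sum_congr rfl fun p _ => ?_
  rw [← mul_assoc, partitionWeight]
  congr 1
  rw [← Finset.prod_inv_distrib, ← Finset.prod_mul_distrib]
  refine Finset.prod_congr rfl fun i _ => ?_
  rw [div_pow, mul_inv]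
  ring

theorem partitionFunction_eq (θ : ℕ → ℝ) (n : ℕ) :
    partitionFunction θ n = partitionSum θ n fun _ => 1 := by
  have h := sum_weight_mul θ n fun _ => 1
  simp only [mul_one] at h
  rw [partitionFunction, h, ← mul_assoc, one_div, inv_mul_cancel₀ (by positivity), one_mul]

theorem partitionWeight_cons (θ : ℕ → ℝ) {n j : ℕ} (hj : 1 ≤ j) (hjn : j ≤ n)
    (p : n.Partition) (q : (n - j).Partition) (h : p.parts = j ::ₘ q.parts) :
    partitionWeight θ p * p.parts.count j = θ j / j * partitionWeight θ q := by
  have hq : partitionWeight θ q = ∏ i ∈ Finset.Icc 1 n,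
      (θ i / i) ^ q.parts.count i / ((q.parts.count i).factorial : ℝ) := by
    refine Finset.prod_subset (Finset.Icc_subset_Icc_right (Nat.sub_le n j)) fun i hi hi' => ?_
    have : q.parts.count i = 0 := Multiset.count_eq_zero.2 fun h => hi' <|
      Finset.mem_Icc.2 ⟨(Finset.mem_Icc.1 hi).1, Nat.Partition.le_of_mem_parts h⟩
    simp [this]
  have hmem : j ∈ Finset.Icc 1 n := Finset.mem_Icc.2 ⟨hj, hjn⟩
  rw [hq, partitionWeight, ← Finset.mul_prod_erase _ _ hmem, ← Finset.mul_prod_erase _ _ hmem]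
  have he : ∏ i ∈ (Finset.Icc 1 n).erase j,
      (θ i / i) ^ p.parts.count i / ((p.parts.count i).factorial : ℝ) =
      ∏ i ∈ (Finset.Icc 1 n).erase j,
      (θ i / i) ^ q.parts.count i / ((q.parts.count i).factorial : ℝ) := by
    refine Finset.prod_congr rfl fun i hi => ?_
    rw [h, Multiset.count_cons_of_ne (Finset.mem_erase.1 hi).1]
  rw [he, h, Multiset.count_cons_self, Nat.factorial_succ, pow_succ]
  have : (((q.parts.count j).factorial : ℕ) : ℝ) ≠ 0 := by positivity
  push_cast
  field_simp

/-- Removing one part of length `j` from a partition in which one such part is marked. -/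
theorem partitionSum_count_mul (θ : ℕ → ℝ) {n j : ℕ} (hj : 1 ≤ j) (hjn : j ≤ n)
    (φ : Multiset ℕ → ℝ) :
    partitionSum θ n (fun s => s.count j * φ s) =
      θ j / j * partitionSum θ (n - j) fun s => φ (j ::ₘ s) := by
  classical
  rw [partitionSum, partitionSum, Finset.mul_sum,
    ← Finset.sum_filter_of_ne (p := fun p : n.Partition => j ∈ p.parts) fun p _ hp => by
      by_contra hmem
      simp [Multiset.count_eq_zero.2 hmem] at hp,
    ← Finset.sum_subtype_eq_sum_filter, Finset.subtype_univ]
  refine Fintype.sum_equiv (Nat.Partition.partitionWithPartEquiv hj hjn) _ _ fun p => ?_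
  have hp : p.1.parts = j ::ₘ (Nat.Partition.partitionWithPartEquiv hj hjn p).parts := by
    rw [Nat.Partition.partitionWithPartEquiv_apply_parts, Multiset.cons_erase p.2]
  rw [← mul_assoc, partitionWeight_cons θ hj hjn _ _ hp, ← hp, mul_assoc]

theorem partitionSum_count_mul_of_lt (θ : ℕ → ℝ) {n j : ℕ} (hjn : n < j)
    (φ : Multiset ℕ → ℝ) : partitionSum θ n (fun s => s.count j * φ s) = 0 := by
  refine Finset.sum_eq_zero fun p _ => ?_
  have : p.parts.count j = 0 := Multiset.count_eq_zero.2 fun h => by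
    have := Nat.Partition.le_of_mem_parts h
    omega
  simp [this]

theorem partitionSum_congr (θ : ℕ → ℝ) {n : ℕ} {φ ψ : Multiset ℕ → ℝ}
    (h : ∀ p : n.Partition, φ p.parts = ψ p.parts) : partitionSum θ n φ = partitionSum θ n ψ :=
  Finset.sum_congr rfl fun p _ => by rw [h p]

theorem partitionSum_const_mul (θ : ℕ → ℝ) (n : ℕ) (c : ℝ) (φ : Multiset ℕ → ℝ) :
    partitionSum θ n (fun s => c * φ s) = c * partitionSum θ n φ := by
  rw [partitionSum, partitionSum, Finset.mul_sum]
  exact Finset.sum_congr rfl fun p _ => by ring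

theorem partitionSum_finsetSum (θ : ℕ → ℝ) (n : ℕ) {ι : Type*} (t : Finset ι)
    (φ : ι → Multiset ℕ → ℝ) :
    partitionSum θ n (fun s => ∑ i ∈ t, φ i s) = ∑ i ∈ t, partitionSum θ n (φ i) := by
  simp only [partitionSum, Finset.mul_sum]
  exact Finset.sum_comm

/-- The `k`-th factorial moment of the number of parts of length `j`, weighted by a function that
ignores the parts of length `j`. -/
theorem partitionSum_choose_mul (θ : ℕ → ℝ) {j : ℕ} (hj : 1 ≤ j) (ψ : Multiset ℕ → ℝ)
    (hψ : ∀ s, ψ (j ::ₘ s) = ψ s) (k n : ℕ) :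
    partitionSum θ n (fun s => ((s.count j).choose k : ℝ) * ψ s) =
      if j * k ≤ n then (θ j / j) ^ k / (k.factorial : ℝ) * partitionSum θ (n - j * k) ψ
      else 0 := by
  induction k generalizing n with
  | zero => simp
  | succ k ih =>
    have key : ∀ s : Multiset ℕ, ((s.count j).choose (k + 1) : ℝ) * ψ s =
        ((k : ℝ) + 1)⁻¹ * ((s.count j : ℝ) * (((s.count j - 1).choose k : ℝ) * ψ s)) := fun s => by
      rcases hs : s.count j with _ | c
      · simp
      · have h := Nat.add_one_mul_choose_eq c k
        have h' : ((c : ℝ) + 1) * (c.choose k : ℝ) = ((c + 1).choose (k + 1) : ℝ) * (k + 1) := by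
          exact_mod_cast h
        have hk : (k : ℝ) + 1 ≠ 0 := by positivity
        rw [Nat.add_sub_cancel, ← mul_assoc _ _ (ψ s)]
        push_cast
        rw [h']
        field_simp
    rw [show (fun s : Multiset ℕ => ((s.count j).choose (k + 1) : ℝ) * ψ s) = _ from funext key,
       partitionSum_const_mul]
    by_cases hjn : j ≤ n
    · rw [partitionSum_count_mul θ hj hjn]
      simp only [Multiset.count_cons_self, Nat.add_sub_cancel, hψ]
      rw [ih (n - j)]
      have e : n - j - j * k = n - j * (k + 1) := by rw [Nat.mul_succ]; omega
      have hk : (k : ℝ) + 1 ≠ 0 := by positivity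
      have hf : (k.factorial : ℝ) ≠ 0 := by positivity
      by_cases h : j * k ≤ n - j
      · rw [if_pos h, if_pos (by rw [Nat.mul_succ]; omega), e, Nat.factorial_succ]
        generalize θ j / (j : ℝ) = b
        push_cast
        field_simp
        ring
      · rw [if_neg h, if_neg (by rw [Nat.mul_succ]; omega)]
        simp
    · rw [partitionSum_count_mul_of_lt θ (by omega), mul_zero, if_neg]
      rw [Nat.mul_succ]
      omega

theorem sum_mul_count_parts {n : ℕ} (p : n.Partition) :
    ∑ j ∈ Finset.Icc 1 n, (j : ℝ) * p.parts.count j = n := by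
  have h := Finset.sum_multiset_count p.parts
  rw [p.parts_sum, Finset.sum_subset (s₂ := Finset.Icc 1 n)] at h
  · conv_rhs => rw [h]
    push_cast
    exact Finset.sum_congr rfl fun i _ => by simp [mul_comm]
  · intro i hi
    rw [Multiset.mem_toFinset] at hi
    exact Finset.mem_Icc.2 ⟨p.parts_pos hi, Nat.Partition.le_of_mem_parts hi⟩
  · intro i _ hi
    rw [Multiset.mem_toFinset, ← Multiset.count_eq_zero] at hi
    simp [hi]

/-- The recursion for the normalization, obtained by removing the cycle of a marked index. -/
theorem mul_partitionFunction (θ : ℕ → ℝ) (n : ℕ) :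
    (n : ℝ) * partitionFunction θ n =
      ∑ j ∈ Finset.Icc 1 n, θ j * partitionFunction θ (n - j) := by
  have h : partitionSum θ n (fun s => ∑ j ∈ Finset.Icc 1 n, (j : ℝ) * (s.count j * 1)) =
      n * partitionFunction θ n := by
    rw [partitionFunction_eq, ← partitionSum_const_mul]
    exact partitionSum_congr θ fun p => by simpa using sum_mul_count_parts p
  rw [← h, partitionSum_finsetSum]
  refine Finset.sum_congr rfl fun j hj => ?_
  obtain ⟨h1, h2⟩ := Finset.mem_Icc.1 hj
  have : (j : ℝ) ≠ 0 := by positivity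
  rw [partitionSum_const_mul, partitionSum_count_mul θ h1 h2, ← partitionFunction_eq]
  field_simp

/-! ### The law of the cycle counts and of the first cycle length -/

theorem weight_conj (θ : ℕ → ℝ) {n : ℕ} (σ τ : Equiv.Perm (Fin n)) :
    weight θ (τ * σ * τ⁻¹) = weight θ σ := by
  have : (τ * σ * τ⁻¹).partition = σ.partition :=
    (Equiv.Perm.partition_eq_of_isConj.1 (isConj_iff.2 ⟨τ, rfl⟩)).symm
  simp only [weight, cycleCount, this]

open scoped Classical in
/-- The length of the cycle of `σ` that contains `i`. -/
noncomputable def cycleLength {n : ℕ} (σ : Equiv.Perm (Fin n)) (i : Fin n) : ℕ :=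
  (Finset.univ.filter fun k => σ.SameCycle i k).card

theorem firstCycleLength_eq {n : ℕ} (σ : Equiv.Perm (Fin (n + 1))) :
    firstCycleLength σ = cycleLength σ 0 := rfl

theorem cycleLength_conj {n : ℕ} (σ τ : Equiv.Perm (Fin n)) (i : Fin n) :
    cycleLength (τ * σ * τ⁻¹) (τ i) = cycleLength σ i := by
  classical
  unfold cycleLength
  symm
  refine Finset.card_equiv τ fun k => ?_
  simp [Equiv.Perm.sameCycle_conj]

/-- The indices that lie in cycles of length `j` number `j` times the count of these cycles. -/
theorem card_cycleLength_eq {n : ℕ} (σ : Equiv.Perm (Fin n)) (j : ℕ) (hj : 1 ≤ j) :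
    (Finset.univ.filter fun i => cycleLength σ i = j).card = j * cycleCount j σ := by
  classical
  have hfix : ∀ i, σ i = i → cycleLength σ i = 1 := fun i hi => by
    rw [cycleLength, Finset.card_eq_one]
    refine ⟨i, ?_⟩
    ext k
    simp only [Finset.mem_filter, Finset.mem_univ, true_and, Finset.mem_singleton]
    refine ⟨fun h => ?_, fun h => h ▸ Equiv.Perm.SameCycle.refl _ _⟩
    obtain ⟨m, hm⟩ := h
    rw [← hm, Equiv.Perm.zpow_apply_eq_self_of_apply_eq_self hi]
  have hmov : ∀ i, σ i ≠ i → cycleLength σ i = (σ.cycleOf i).support.card := fun i hi => by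
    rw [cycleLength]
    congr 1
    ext k
    simp [Equiv.Perm.mem_support_cycleOf_iff' hi]
  have htwo : ∀ i, σ i ≠ i → 2 ≤ cycleLength σ i := fun i hi => by
    rw [hmov i hi]
    exact (Equiv.Perm.isCycle_cycleOf σ hi).two_le_card_support
  -- cycles of length `1` are not recorded in `cycleFactorsFinset`
  rcases hj.eq_or_lt with rfl | hj
  · have h1 : (Finset.univ.filter fun i => cycleLength σ i = 1) = σ.supportᶜ := by
      ext i
      simp only [Finset.mem_filter, Finset.mem_univ, true_and, Finset.mem_compl,
        Equiv.Perm.mem_support, not_not]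
      refine ⟨fun h => ?_, hfix i⟩
      by_contra hi
      have := htwo i hi
      omega
    have h2 : σ.cycleType.count 1 = 0 := Multiset.count_eq_zero.2 fun h => by
      have := Equiv.Perm.two_le_of_mem_cycleType h
      omega
    rw [h1, Finset.card_compl, one_mul, cycleCount, Equiv.Perm.parts_partition,
      Multiset.count_add, h2]
    simp
  · have h1 : (Finset.univ.filter fun i => cycleLength σ i = j) =
        (σ.cycleFactorsFinset.filter fun c => c.support.card = j).biUnion
          fun c => c.support := by
      ext i
      simp only [Finset.mem_filter, Finset.mem_univ, true_and, Finset.mem_biUnion]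
      constructor
      · intro h
        have hi : σ i ≠ i := fun hi => by have := hfix i hi; omega
        refine ⟨σ.cycleOf i, ⟨Equiv.Perm.cycleOf_mem_cycleFactorsFinset_iff.2
          (Equiv.Perm.mem_support.2 hi), (hmov i hi).symm.trans h⟩, ?_⟩
        rw [Equiv.Perm.mem_support_cycleOf_iff' hi]
      · rintro ⟨c, ⟨hc, hcj⟩, hi⟩
        have hci := Equiv.Perm.cycle_is_cycleOf hi hc
        have hσ : σ i ≠ i := Equiv.Perm.mem_support.1
          (Equiv.Perm.mem_cycleFactorsFinset_support_le hc hi)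
        rw [hmov i hσ, ← hci, hcj]
    rw [h1, Finset.card_biUnion]
    · rw [Finset.sum_congr rfl (g := fun _ => j) fun c hc => (Finset.mem_filter.1 hc).2,
        Finset.sum_const, smul_eq_mul, mul_comm, cycleCount, Equiv.Perm.parts_partition,
        Multiset.count_add, Multiset.count_replicate, if_neg (by omega), add_zero,
        Equiv.Perm.cycleType_def, Multiset.count_map]
      congr 1
      rw [Finset.card_def, Finset.filter_val]
      simp [eq_comm]
    · intro c hc d hd hcd
      exact (Equiv.Perm.cycleFactorsFinset_pairwise_disjoint σ
        (Finset.mem_filter.1 hc).1 (Finset.mem_filter.1 hd).1 hcd).disjoint_support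

/-- All indices play the same role, so the first one can be averaged over. -/
theorem sum_weight_firstCycleLength (θ : ℕ → ℝ) {n j : ℕ} (hn : 1 ≤ n) (hj : 1 ≤ j) :
    (n : ℝ) * ∑ σ : Equiv.Perm (Fin n), weight θ σ * (if firstCycleLength σ = j then 1 else 0) =
      (j : ℝ) * ∑ σ : Equiv.Perm (Fin n), weight θ σ * (cycleCount j σ : ℝ) := by
  obtain ⟨n, rfl⟩ : ∃ m, n = m + 1 := ⟨n - 1, by omega⟩
  have h1 : ∀ i : Fin (n + 1),
      ∑ σ : Equiv.Perm (Fin (n + 1)), weight θ σ * (if cycleLength σ i = j then (1 : ℝ) else 0) =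
      ∑ σ : Equiv.Perm (Fin (n + 1)),
        weight θ σ * (if firstCycleLength σ = j then (1 : ℝ) else 0) := fun i => by
    symm
    -- conjugation by the transposition of `0` and `i` preserves the weight
    refine Fintype.sum_equiv (MulAut.conj (Equiv.swap 0 i)).toEquiv _ _ fun σ => ?_
    have h := cycleLength_conj σ (Equiv.swap 0 i) 0
    rw [Equiv.swap_apply_left] at h
    change _ = weight θ (Equiv.swap 0 i * σ * (Equiv.swap 0 i)⁻¹) *
      if cycleLength (Equiv.swap 0 i * σ * (Equiv.swap 0 i)⁻¹) i = j then 1 else 0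
    rw [weight_conj, firstCycleLength_eq]
    simp only [h]
  have h2 := Finset.sum_congr (s₁ := (Finset.univ : Finset (Fin (n + 1)))) rfl fun i _ => h1 i
  rw [Finset.sum_const, Finset.card_univ, Fintype.card_fin, nsmul_eq_mul, Finset.sum_comm] at h2
  rw [← h2, Finset.mul_sum]
  refine Finset.sum_congr rfl fun σ _ => ?_
  rw [← Finset.mul_sum, Finset.sum_boole, card_cycleLength_eq σ j hj]
  push_cast
  ring

theorem weight_pos {θ : ℕ → ℝ} (hθ : ∀ j, 1 ≤ j → 0 < θ j) {n : ℕ} (σ : Equiv.Perm (Fin n)) :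
    0 < weight θ σ :=
  Finset.prod_pos fun j hj => pow_pos (hθ j (Finset.mem_Icc.1 hj).1) _

theorem partitionFunction_pos {θ : ℕ → ℝ} (hθ : ∀ j, 1 ≤ j → 0 < θ j) (n : ℕ) :
    0 < partitionFunction θ n :=
  mul_pos (by positivity) (Finset.sum_pos (fun σ _ => weight_pos hθ σ) Finset.univ_nonempty)

theorem isProbabilityMeasure_permLaw {θ : ℕ → ℝ} (hθ : ∀ j, 1 ≤ j → 0 < θ j) (n : ℕ) :
    IsProbabilityMeasure (permLaw θ n) := by
  have hh := partitionFunction_pos hθ n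
  refine ⟨?_⟩
  simp only [permLaw, Measure.coe_finsetSum, Measure.coe_smul, Finset.sum_apply, Pi.smul_apply,
    measure_univ, smul_eq_mul, mul_one]
  rw [← ENNReal.ofReal_sum_of_nonneg fun σ _ => by
    have := weight_pos hθ σ
    positivity, ← Finset.mul_sum, ← ENNReal.ofReal_one]
  congr 1
  have : ∑ σ : Equiv.Perm (Fin n), weight θ σ = n.factorial * partitionFunction θ n := by
    rw [partitionFunction, ← mul_assoc, mul_one_div_cancel (by positivity), one_mul]
  rw [this, one_div, inv_mul_cancel₀ (by positivity)]

theorem integral_permLaw {θ : ℕ → ℝ} (hθ : ∀ j, 1 ≤ j → 0 < θ j) (n : ℕ)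
    (f : Equiv.Perm (Fin n) → ℝ) :
    ∫ σ, f σ ∂(permLaw θ n) =
      1 / ((n.factorial : ℝ) * partitionFunction θ n) * ∑ σ, weight θ σ * f σ := by
  have hh := partitionFunction_pos hθ n
  have hint : ∀ σ : Equiv.Perm (Fin n), Integrable f (Measure.dirac σ) := fun σ =>
    integrable_dirac (by simp)
  rw [permLaw, integral_finsetSum_measure fun σ _ => (hint σ).smul_measure ENNReal.ofReal_ne_top,
    Finset.mul_sum]
  refine Finset.sum_congr rfl fun σ _ => ?_
  have := weight_pos hθ σ
  rw [integral_smul_measure, integral_dirac, ENNReal.toReal_ofReal (by positivity), smul_eq_mul]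
  ring

theorem integral_permLaw_parts {θ : ℕ → ℝ} (hθ : ∀ j, 1 ≤ j → 0 < θ j) (n : ℕ)
    (φ : Multiset ℕ → ℝ) :
    ∫ σ, φ σ.partition.parts ∂(permLaw θ n) =
      partitionSum θ n φ / partitionFunction θ n := by
  have hh := partitionFunction_pos hθ n
  rw [integral_permLaw hθ, sum_weight_mul]
  field_simp

/-- The mass `θ_j h_{n-j} / (n h_n)` that the law of the first cycle length gives to `j`. -/
noncomputable def firstCycleMass (θ : ℕ → ℝ) (n j : ℕ) : ℝ :=
  if 1 ≤ j ∧ j ≤ n then θ j * partitionFunction θ (n - j) / (n * partitionFunction θ n) else 0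

theorem firstCycleMass_nonneg {θ : ℕ → ℝ} (hθ : ∀ j, 1 ≤ j → 0 < θ j) (n j : ℕ) :
    0 ≤ firstCycleMass θ n j := by
  unfold firstCycleMass
  split_ifs with h
  · have := hθ j h.1
    have := partitionFunction_pos hθ n
    have := partitionFunction_pos hθ (n - j)
    positivity
  · exact le_rfl

theorem sum_weight_cycleCount (θ : ℕ → ℝ) {n j : ℕ} (hj : 1 ≤ j) (hjn : j ≤ n) :
    ∑ σ : Equiv.Perm (Fin n), weight θ σ * (cycleCount j σ : ℝ) =
      n.factorial * (θ j / j * partitionFunction θ (n - j)) := by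
  have := sum_weight_mul θ n fun s => (s.count j : ℝ) * 1
  rw [partitionSum_count_mul θ hj hjn, ← partitionFunction_eq] at this
  rw [← this]
  simp [cycleCount]

theorem sum_firstCycleMass {θ : ℕ → ℝ} (hθ : ∀ j, 1 ≤ j → 0 < θ j) {n : ℕ} (hn : 1 ≤ n) :
    ∑ j ∈ Finset.Icc 1 n, firstCycleMass θ n j = 1 := by
  have hh := partitionFunction_pos hθ n
  have hn' : (0 : ℝ) < n := by exact_mod_cast hn
  have hmass : ∀ j ∈ Finset.Icc 1 n, firstCycleMass θ n j =
      θ j * partitionFunction θ (n - j) / (n * partitionFunction θ n) := fun j hj =>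
    if_pos (Finset.mem_Icc.1 hj)
  rw [Finset.sum_congr rfl hmass, ← Finset.sum_div,
    ← mul_partitionFunction, div_self (by positivity)]

theorem firstCycleLength_mem {n : ℕ} (hn : 1 ≤ n) (σ : Equiv.Perm (Fin n)) :
    firstCycleLength σ ∈ Finset.Icc 1 n := by
  classical
  obtain ⟨n, rfl⟩ : ∃ m, n = m + 1 := ⟨n - 1, by omega⟩
  rw [firstCycleLength_eq, cycleLength, Finset.mem_Icc]
  refine ⟨Finset.card_pos.2 ⟨0, by simp [Equiv.Perm.SameCycle.refl]⟩,
    (Finset.card_filter_le _ _).trans (by simp)⟩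

theorem integral_firstCycleLength {θ : ℕ → ℝ} (hθ : ∀ j, 1 ≤ j → 0 < θ j) {n : ℕ} (hn : 1 ≤ n)
    (φ : ℕ → ℝ) :
    ∫ σ, φ (firstCycleLength σ) ∂(permLaw θ n) =
      ∑ j ∈ Finset.Icc 1 n, φ j * firstCycleMass θ n j := by
  classical
  have hh := partitionFunction_pos hθ n
  have hn' : (0 : ℝ) < n := by exact_mod_cast hn
  have hφ : ∀ σ : Equiv.Perm (Fin n), weight θ σ * φ (firstCycleLength σ) =
      ∑ j ∈ Finset.Icc 1 n, φ j * (weight θ σ * if firstCycleLength σ = j then 1 else 0) :=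
    fun σ => by
      simp [firstCycleLength_mem hn σ, mul_comm]
  rw [integral_permLaw hθ, Finset.sum_congr rfl fun σ _ => hφ σ, Finset.sum_comm, Finset.mul_sum]
  refine Finset.sum_congr rfl fun j hj => ?_
  obtain ⟨h1, h2⟩ := Finset.mem_Icc.1 hj
  have hj' : (0 : ℝ) < j := by exact_mod_cast h1
  have h := sum_weight_firstCycleLength θ hn h1
  rw [sum_weight_cycleCount θ h1 h2] at h
  rw [← Finset.mul_sum, firstCycleMass, if_pos ⟨h1, h2⟩]
  have h' : ∑ σ : Equiv.Perm (Fin n), weight θ σ * (if firstCycleLength σ = j then 1 else 0) =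
      n.factorial * (θ j * partitionFunction θ (n - j)) / n := by
    rw [eq_div_iff hn'.ne', mul_comm, h]
    field_simp
  rw [h']
  field_simp

/-- The expected number of cycles is the sum over all indices of the expected inverse length of
their cycles. -/
theorem integral_numCycles {θ : ℕ → ℝ} (hθ : ∀ j, 1 ≤ j → 0 < θ j) {n : ℕ} (hn : 1 ≤ n) :
    ∫ σ, (numCycles σ : ℝ) ∂(permLaw θ n) =
      n * ∑ j ∈ Finset.Icc 1 n, (j : ℝ)⁻¹ * firstCycleMass θ n j := by
  have hh := partitionFunction_pos hθ n
  have hn' : (0 : ℝ) < n := by exact_mod_cast hn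
  simp only [integral_permLaw hθ, numCycles, Nat.cast_sum, Finset.mul_sum]
  rw [Finset.sum_comm]
  refine Finset.sum_congr rfl fun j hj => ?_
  obtain ⟨h1, h2⟩ := Finset.mem_Icc.1 hj
  have hj' : (0 : ℝ) < j := by exact_mod_cast h1
  rw [← Finset.mul_sum, sum_weight_cycleCount θ h1 h2, firstCycleMass, if_pos ⟨h1, h2⟩]
  field_simp

/-! ### Log-concavity of sequences with a log-concave recursion kernel -/

/-- The Cauchy–Binet identity expresses the difference of the two sides through products of
`2 × 2` minors; the signs of the minors give the inequality. -/
theorem sum_mul_sum_le_of_minors (s : Finset ℕ) (x y a b : ℕ → ℝ)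
    (hxy : ∀ i ∈ s, ∀ j ∈ s, i ≤ j → x j * y i ≤ x i * y j)
    (hab : ∀ i ∈ s, ∀ j ∈ s, i ≤ j → a i * b j ≤ a j * b i) :
    (∑ i ∈ s, x i * a i) * (∑ i ∈ s, y i * b i) ≤
      (∑ i ∈ s, x i * b i) * ∑ i ∈ s, y i * a i := by
  have h1 : (∑ i ∈ s, x i * a i) * (∑ i ∈ s, y i * b i) -
      (∑ i ∈ s, x i * b i) * (∑ i ∈ s, y i * a i) =
      ∑ i ∈ s, ∑ j ∈ s, x i * y j * (a i * b j - a j * b i) := by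
    rw [Finset.sum_mul_sum, Finset.sum_mul_sum, ← Finset.sum_sub_distrib]
    refine Finset.sum_congr rfl fun i _ => ?_
    rw [← Finset.sum_sub_distrib]
    exact Finset.sum_congr rfl fun j _ => by ring
  have h2 := h1
  rw [Finset.sum_comm] at h2
  -- adding the double sum to its transpose groups the terms into products of two minors
  have h3 : ∑ i ∈ s, ∑ j ∈ s, x i * y j * (a i * b j - a j * b i) +
      ∑ i ∈ s, ∑ j ∈ s, x j * y i * (a j * b i - a i * b j) ≤ 0 := by
    rw [← Finset.sum_add_distrib]
    refine Finset.sum_nonpos fun i hi => ?_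
    rw [← Finset.sum_add_distrib]
    refine Finset.sum_nonpos fun j hj => ?_
    rcases le_total i j with hij | hij
    · nlinarith [hxy i hi j hj hij, hab i hi j hj hij]
    · nlinarith [hxy j hj i hi hij, hab j hj i hi hij]
  linarith

/-- If `(n + 1) H_{n+1} = ∑_{j ≤ n} X_{j+1} H_{n-j}` with `X` log-concave and `X_0 ≥ 1`, then `H` is
log-concave. The value `X_0` does not enter the recursion, but it enters the hypothesis that `X`
is log-concave. -/
theorem logConcave_of_recursion {X H : ℕ → ℝ} (hX0 : 1 ≤ X 0)
    (hX : ∀ i j, i ≤ j → X (j + 1) * X i ≤ X (i + 1) * X j) (hH : ∀ n, 0 < H n)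
    (hrec : ∀ n : ℕ, ((n : ℝ) + 1) * H (n + 1) = ∑ j ∈ Finset.range (n + 1), X (j + 1) * H (n - j))
    (n : ℕ) : H (n + 2) * H n ≤ H (n + 1) * H (n + 1) := by
  -- `g` is the shifted sequence, with the value `0` for the missing term of index `-1`
  obtain ⟨g, hg0, hg⟩ : ∃ g : ℕ → ℝ, g 0 = 0 ∧ ∀ m, g (m + 1) = H m :=
    ⟨fun m => Nat.casesOn m 0 H, rfl, fun _ => rfl⟩
  have hgn : ∀ m, 0 ≤ g m := fun m => by
    cases m with
    | zero => exact hg0.ge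
    | succ m => rw [hg]; exact (hH m).le
  have step : ∀ n, (∀ m m', m ≤ m' → m' ≤ n + 1 → H m' * g m ≤ H m * g m') →
      H (n + 2) * H n ≤ H (n + 1) * H (n + 1) := by
    intro n ih
    have key := sum_mul_sum_le_of_minors (Finset.range (n + 2)) (fun j => X (j + 1)) X
      (fun j => H (n + 1 - j)) (fun j => g (n + 1 - j)) (fun i _ j _ hij => hX i j hij)
      (fun i _ j _ hij => ih _ _ (by omega) (by omega))
    have hA : ∑ j ∈ Finset.range (n + 2), X (j + 1) * H (n + 1 - j) = (n + 2) * H (n + 2) := by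
      rw [← hrec (n + 1)]
      push_cast
      ring
    have hB : ∑ j ∈ Finset.range (n + 2), X (j + 1) * g (n + 1 - j) = (n + 1) * H (n + 1) := by
      rw [Finset.sum_range_succ, Nat.sub_self, hg0, mul_zero, add_zero, hrec]
      refine Finset.sum_congr rfl fun j hj => ?_
      have := Finset.mem_range.1 hj
      rw [show n + 1 - j = n - j + 1 by omega, hg]
    have hC : ∑ j ∈ Finset.range (n + 2), X j * H (n + 1 - j) = (n + 1 + X 0) * H (n + 1) := by
      rw [Finset.sum_range_succ', Nat.sub_zero, add_mul, hrec]
      congr 1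
      exact Finset.sum_congr rfl fun j _ => by rw [Nat.add_sub_add_right]
    have hD : ∑ j ∈ Finset.range (n + 2), X j * g (n + 1 - j) = (n + X 0) * H n := by
      rw [Finset.sum_range_succ', Nat.sub_zero, hg, add_mul]
      congr 1
      rw [Finset.sum_range_succ, Nat.sub_self, hg0, mul_zero, add_zero]
      cases n with
      | zero => simp
      | succ k =>
        push_cast
        rw [hrec]
        refine Finset.sum_congr rfl fun j hj => ?_
        have := Finset.mem_range.1 hj
        rw [show k + 1 - j = k - j + 1 by omega, hg]
    rw [hA, hB, hC, hD] at key
    have hn : (0 : ℝ) ≤ n := n.cast_nonneg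
    -- the only place where `X 0 ≥ 1` is used
    have h1 : ((n : ℝ) + 1) * (n + 1 + X 0) ≤ (n + 2) * (n + X 0) := by nlinarith
    have h2 : 0 < H (n + 1) * H (n + 1) := mul_pos (hH _) (hH _)
    have h3 : 0 < ((n : ℝ) + 2) * (n + X 0) := by positivity
    have h4 := mul_le_mul_of_nonneg_right h1 h2.le
    refine le_of_mul_le_mul_left ?_ h3
    linarith
  have main : ∀ n m m', m ≤ m' → m' ≤ n → H m' * g m ≤ H m * g m' := by
    intro n
    induction n with
    | zero =>
      intro m m' h h'
      obtain rfl : m' = 0 := by omega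
      obtain rfl : m = 0 := by omega
      exact le_rfl
    | succ n ih =>
      intro m m' h h'
      rcases h'.lt_or_eq with h' | rfl
      · exact ih m m' h (by omega)
      rcases h.lt_or_eq with h | rfl
      · cases n with
        | zero =>
          obtain rfl : m = 0 := by omega
          rw [hg0, hg, mul_zero]
          exact (mul_pos (hH _) (hH _)).le
        | succ k =>
          have h1 := step k ih
          have h2 := ih m (k + 1) (by omega) le_rfl
          rw [hg] at h2 ⊢
          have h3 := mul_le_mul_of_nonneg_right h1 (hgn m)
          have h4 := mul_le_mul_of_nonneg_left h2 (hH (k + 1)).le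
          refine le_of_mul_le_mul_left ?_ (hH k)
          linarith
      · exact le_rfl
  exact step n (main (n + 1))

theorem le_pow_mul {H : ℕ → ℝ} {Z : ℝ} {m : ℕ} (hZ : 0 ≤ Z) (j : ℕ)
    (h : ∀ i, m ≤ i → i < m + j → H i ≤ Z * H (i + 1)) : H m ≤ Z ^ j * H (m + j) := by
  induction j with
  | zero => simp
  | succ j ih =>
    refine (ih fun i h1 h2 => h i h1 (by omega)).trans ?_
    rw [pow_succ, mul_assoc]
    exact mul_le_mul_of_nonneg_left (h (m + j) (by omega) (by omega)) (by positivity)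

theorem pow_mul_le {H : ℕ → ℝ} {w : ℝ} {m : ℕ} (hw : 0 ≤ w) (j : ℕ)
    (h : ∀ i, m ≤ i → w * H (i + 1) ≤ H i) : w ^ j * H (m + j) ≤ H m := by
  induction j with
  | zero => simp
  | succ j ih =>
    refine le_trans ?_ ih
    rw [pow_succ, mul_assoc]
    exact mul_le_mul_of_nonneg_left (h (m + j) (by omega)) (by positivity)

theorem monotone_ratio {H : ℕ → ℝ} (hH : ∀ n, 0 < H n)
    (hlc : ∀ n, H (n + 2) * H n ≤ H (n + 1) * H (n + 1)) :
    Monotone fun n => H n / H (n + 1) :=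
  monotone_nat_of_le_succ fun n => by
    rw [div_le_div_iff₀ (hH _) (hH _)]
    linarith [hlc n]

/-- Log-concavity bounds every ratio `H_{n+1-j} / H_{n+1}` by a power of the ratio with `j = 1`, so
the recursion bounds `n + 1` by a power sum. -/
theorem add_one_le_sum_pow {X H : ℕ → ℝ} (hX : ∀ n, 0 ≤ X n) (hH : ∀ n, 0 < H n)
    (hlc : ∀ n, H (n + 2) * H n ≤ H (n + 1) * H (n + 1))
    (hrec : ∀ n : ℕ, ((n : ℝ) + 1) * H (n + 1) = ∑ j ∈ Finset.range (n + 1), X (j + 1) * H (n - j))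
    (n : ℕ) :
    (n : ℝ) + 1 ≤ ∑ j ∈ Finset.range (n + 1), X (j + 1) * (H n / H (n + 1)) ^ (j + 1) := by
  refine le_of_mul_le_mul_right ?_ (hH (n + 1))
  rw [hrec, Finset.sum_mul]
  refine Finset.sum_le_sum fun j hj => ?_
  rw [mul_assoc]
  refine mul_le_mul_of_nonneg_left ?_ (hX _)
  have hj := Finset.mem_range.1 hj
  have := le_pow_mul (H := H) (m := n - j) (Z := H n / H (n + 1))
    (div_pos (hH _) (hH _)).le (j + 1) fun i _ hi => by
      have := monotone_ratio hH hlc (show i ≤ n by omega)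
      rwa [← div_le_iff₀ (hH _)]
  rwa [show n - j + (j + 1) = n + 1 by omega] at this

theorem tendsto_rpow_div_self {β : ℝ} (hβ : β < 1) :
    Tendsto (fun n : ℕ => ((n : ℝ) + 1) ^ β / ((n : ℝ) + 1)) atTop (𝓝 0) := by
  have h1 : Tendsto (fun n : ℕ => (n : ℝ) + 1) atTop atTop :=
    tendsto_atTop_add_const_right _ _ tendsto_natCast_atTop_atTop
  have h2 := (tendsto_rpow_neg_atTop (sub_pos.2 hβ)).comp h1
  refine h2.congr fun n => ?_
  have : (0 : ℝ) < n + 1 := by positivity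
  simp only [Function.comp]
  rw [neg_sub, Real.rpow_sub_one this.ne']

/-- The asymptotic lower bound for the ratios of consecutive terms. If `z = H_n / H_{n+1}` were
smaller, then `n + 1 ≤ G / (1 - z) ^ (γ + 1) + d / (1 - z)` would fail for large `n`: the first
summand is at most `(n + 1) G / c ^ (γ + 1)` with `G / c ^ (γ + 1) < 1`, and the second one is
`o(n)`. -/
theorem eventually_le_ratio {X H : ℕ → ℝ} {γ G d c : ℝ} (hγ : 0 < γ) (hG : 0 ≤ G) (hd : 0 ≤ d)
    (hX : ∀ n, 0 ≤ X n) (hH : ∀ n, 0 < H n)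
    (hlc : ∀ n, H (n + 2) * H n ≤ H (n + 1) * H (n + 1))
    (hrec : ∀ n : ℕ, ((n : ℝ) + 1) * H (n + 1) = ∑ j ∈ Finset.range (n + 1), X (j + 1) * H (n - j))
    (hsum : ∀ z : ℝ, 0 ≤ z → z < 1 → ∀ n : ℕ, ∑ j ∈ Finset.range n, X (j + 1) * z ^ (j + 1) ≤
      G / (1 - z) ^ (γ + 1) + d / (1 - z))
    (hc : 0 < c) (hGc : G < c ^ (γ + 1)) :
    ∀ᶠ n : ℕ in atTop, 1 - c / ((n : ℝ) + 1) ^ (1 / (γ + 1)) ≤ H n / H (n + 1) := by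
  have hγ1 : 0 < γ + 1 := by linarith
  have hlim := (tendsto_rpow_div_self (β := 1 / (γ + 1))
    (by rw [div_lt_one hγ1]; linarith)).const_mul (d / c)
  rw [mul_zero] at hlim
  have hpos : 0 < 1 - G / c ^ (γ + 1) := by
    rw [sub_pos, div_lt_one (by positivity)]
    exact hGc
  filter_upwards [hlim.eventually (gt_mem_nhds hpos)] with n hn
  by_contra! hlt
  set z := H n / H (n + 1) with hz
  set M := ((n : ℝ) + 1) ^ (1 / (γ + 1)) with hM
  have hn1 : (0 : ℝ) < n + 1 := by positivity
  have hMpos : 0 < M := by positivity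
  have hMpow : M ^ (γ + 1) = n + 1 := by
    rw [hM, ← Real.rpow_mul hn1.le, one_div_mul_cancel hγ1.ne', Real.rpow_one]
  have hz0 : 0 < z := div_pos (hH _) (hH _)
  have hw : c / M < 1 - z := by linarith
  have hcM : 0 < c / M := by positivity
  have h1 := (add_one_le_sum_pow hX hH hlc hrec n).trans (hsum z hz0.le (by linarith) (n + 1))
  have h2 : G / (1 - z) ^ (γ + 1) ≤ G / (c / M) ^ (γ + 1) := by gcongr
  have h3 : d / (1 - z) ≤ d / (c / M) := by gcongr
  rw [Real.div_rpow hc.le hMpos.le, hMpow] at h2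
  have h4 : (n : ℝ) + 1 ≤ (n + 1) * (G / c ^ (γ + 1)) + d / c * M := by
    calc (n : ℝ) + 1 ≤ _ := h1
      _ ≤ G / (c ^ (γ + 1) / (n + 1)) + d / (c / M) := add_le_add h2 h3
      _ = _ := by field_simp
  have h5 : d / c * M < (n + 1) * (1 - G / c ^ (γ + 1)) := by
    rw [← mul_div_assoc, div_lt_iff₀ hn1] at hn
    linarith
  linarith

theorem logConcave_general {X : ℕ → ℝ} (hX : ∀ n, 0 < X n)
    (h : ∀ n, X (n + 2) * X n ≤ X (n + 1) * X (n + 1)) (i j : ℕ) (hij : i ≤ j) :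
    X (j + 1) * X i ≤ X (i + 1) * X j := by
  have := monotone_ratio hX h hij
  rw [div_le_div_iff₀ (hX _) (hX _)] at this
  linarith

/-! ### Partial sums and monotonicity -/

/-- Passing from `h` to its partial sums multiplies the generating function by `1 / (1 - z)` and so
adds `1` to every term of the recursion kernel. -/
theorem partialSum_recursion {θ h : ℕ → ℝ}
    (hrec : ∀ n : ℕ, ((n : ℝ) + 1) * h (n + 1) = ∑ j ∈ Finset.range (n + 1), θ (j + 1) * h (n - j))
    (n : ℕ) :
    ((n : ℝ) + 1) * (∑ i ∈ Finset.range (n + 2), h i) =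
      ∑ j ∈ Finset.range (n + 1), (θ (j + 1) + 1) * ∑ i ∈ Finset.range (n - j + 1), h i := by
  induction n with
  | zero =>
    have := hrec 0
    simp [Finset.sum_range_succ] at this ⊢
    linarith
  | succ n ih =>
    have h1 := hrec (n + 1)
    rw [Finset.sum_range_succ] at h1
    have h2 : ∑ j ∈ Finset.range (n + 1), (θ (j + 1) + 1) *
        ∑ i ∈ Finset.range (n + 1 - j + 1), h i =
        ∑ j ∈ Finset.range (n + 1), (θ (j + 1) + 1) * ∑ i ∈ Finset.range (n - j + 1), h i +
        ∑ j ∈ Finset.range (n + 1), θ (j + 1) * h (n + 1 - j) +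
        ∑ j ∈ Finset.range (n + 1), h (n + 1 - j) := by
      rw [← Finset.sum_add_distrib, ← Finset.sum_add_distrib]
      refine Finset.sum_congr rfl fun j hj => ?_
      have := Finset.mem_range.1 hj
      rw [show n + 1 - j = n - j + 1 by omega, Finset.sum_range_succ _ (n - j + 1)]
      ring
    have h3 : ∑ j ∈ Finset.range (n + 1), h (n + 1 - j) =
        ∑ j ∈ Finset.range (n + 1), h (j + 1) := by
      rw [← Finset.sum_range_reflect]
      refine Finset.sum_congr rfl fun j hj => ?_
      have := Finset.mem_range.1 hj
      congr 1
      omega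
    have h4 := Finset.sum_range_succ' h (n + 1)
    have h5 := Finset.sum_range_succ h (n + 2)
    rw [Finset.sum_range_succ (fun j => (θ (j + 1) + 1) *
      ∑ i ∈ Finset.range (n + 1 - j + 1), h i) (n + 1), h2, ← ih, h3]
    simp only [Nat.sub_self, zero_add, Finset.sum_range_one] at h1 ⊢
    push_cast at h1 ⊢
    nlinarith

/-- The increments of `h` satisfy the recursion with kernel `θ_j - 1`, which is nonnegative. -/
theorem monotone_of_recursion {θ h : ℕ → ℝ} (hθ : ∀ j, 1 ≤ θ (j + 1)) (h0 : 0 ≤ h 0)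
    (hrec : ∀ n : ℕ, ((n : ℝ) + 1) * h (n + 1) =
      ∑ j ∈ Finset.range (n + 1), θ (j + 1) * h (n - j)) :
    Monotone h := by
  have key : ∀ n : ℕ, ((n : ℝ) + 1) * (h (n + 1) - h n) =
      (θ (n + 1) - 1) * h 0 +
        ∑ j ∈ Finset.range n, (θ (j + 1) - 1) * (h (n - j) - h (n - j - 1)) := by
    intro n
    have h1 := hrec n
    rw [Finset.sum_range_succ, Nat.sub_self] at h1
    have h2 : (n : ℝ) * h n = ∑ j ∈ Finset.range n, θ (j + 1) * h (n - j - 1) := by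
      cases n with
      | zero => simp
      | succ k =>
        push_cast
        rw [hrec]
        refine Finset.sum_congr rfl fun j _ => ?_
        congr 2
        omega
    have h3 : ∑ j ∈ Finset.range n, (h (n - j) - h (n - j - 1)) = h n - h 0 := by
      rw [← Finset.sum_range_sub h n, ← Finset.sum_range_reflect]
      refine Finset.sum_congr rfl fun j hj => ?_
      have := Finset.mem_range.1 hj
      congr 2 <;> omega
    have h4 : ∑ j ∈ Finset.range n, (θ (j + 1) - 1) * (h (n - j) - h (n - j - 1)) =
        ∑ j ∈ Finset.range n, θ (j + 1) * h (n - j) -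
        ∑ j ∈ Finset.range n, θ (j + 1) * h (n - j - 1) -
        ∑ j ∈ Finset.range n, (h (n - j) - h (n - j - 1)) := by
      rw [← Finset.sum_sub_distrib, ← Finset.sum_sub_distrib]
      exact Finset.sum_congr rfl fun j _ => by ring
    rw [h4, h3, ← h2]
    linarith
  have hmono : ∀ n, h n ≤ h (n + 1) := by
    intro n
    induction n using Nat.strong_induction_on with
    | _ n ih =>
      have h1 : 0 ≤ ((n : ℝ) + 1) * (h (n + 1) - h n) := by
        rw [key]
        refine add_nonneg (mul_nonneg (sub_nonneg.2 (hθ n)) h0)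
          (Finset.sum_nonneg fun j hj => mul_nonneg (sub_nonneg.2 (hθ j)) ?_)
        have := Finset.mem_range.1 hj
        have h2 := ih (n - j - 1) (by omega)
        rw [show n - j - 1 + 1 = n - j by omega] at h2
        exact sub_nonneg.2 h2
      have h2 := nonneg_of_mul_nonneg_right h1 (by positivity)
      linarith
  exact monotone_nat_of_le_succ hmono

/-! ### The sequence `Γ(γ + n + 1) / n!` -/

/-- The sequence `Γ(γ + n + 1) / n!`. Its value `Γ(γ + 1)` at `0` is not a parameter of the model,
but the natural continuation of the sequence. -/
noncomputable def gammaCoeff (γ : ℝ) (n : ℕ) : ℝ :=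
  Real.Gamma (γ + n + 1) / (n.factorial : ℝ)

theorem gammaCoeff_zero (γ : ℝ) : gammaCoeff γ 0 = Real.Gamma (γ + 1) := by
  simp [gammaCoeff]

theorem gammaCoeff_pos {γ : ℝ} (hγ : 0 < γ) (n : ℕ) : 0 < gammaCoeff γ n :=
  div_pos (Real.Gamma_pos_of_pos (by positivity)) (by positivity)

theorem gammaCoeff_succ {γ : ℝ} (hγ : 0 < γ) (n : ℕ) :
    gammaCoeff γ (n + 1) * (n + 1) = (γ + n + 1) * gammaCoeff γ n := by
  have h : γ + n + 1 ≠ 0 := by positivity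
  have h1 : Real.Gamma (γ + (n + 1 : ℕ) + 1) = (γ + n + 1) * Real.Gamma (γ + n + 1) := by
    rw [← Real.Gamma_add_one h]
    push_cast
    ring_nf
  have h2 : (n.factorial : ℝ) ≠ 0 := by positivity
  rw [gammaCoeff, gammaCoeff, h1, Nat.factorial_succ]
  push_cast
  field_simp

theorem gammaCoeff_succ_eq {γ : ℝ} (hγ : 0 < γ) (n : ℕ) :
    gammaCoeff γ (n + 1) = gammaCoeff γ n + gammaCoeff γ n * (γ / (n + 1)) := by
  have h := gammaCoeff_succ hγ n
  have h1 : (n : ℝ) + 1 ≠ 0 := by positivity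
  field_simp
  linarith

theorem one_le_gammaCoeff {γ : ℝ} (hγ : 0 < γ) (n : ℕ) : 1 ≤ gammaCoeff γ (n + 1) := by
  induction n with
  | zero =>
    have h : Real.Gamma 2 ≤ Real.Gamma (γ + 2) :=
      Real.Gamma_strictMonoOn_Ici.monotoneOn (by simp) (by simp [hγ.le]) (by linarith)
    rw [Real.Gamma_two] at h
    have e : γ + ((0 + 1 : ℕ) : ℝ) + 1 = γ + 2 := by push_cast; ring
    rw [gammaCoeff, e]
    simpa using h
  | succ n ih =>
    rw [gammaCoeff_succ_eq hγ]
    have := gammaCoeff_pos hγ (n + 1)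
    have : 0 ≤ gammaCoeff γ (n + 1) * (γ / ((n + 1 : ℕ) + 1)) := by positivity
    linarith

theorem logConcave_gammaCoeff {γ : ℝ} (hγ : 0 < γ) (n : ℕ) :
    gammaCoeff γ (n + 2) * gammaCoeff γ n ≤ gammaCoeff γ (n + 1) * gammaCoeff γ (n + 1) := by
  have h0 := gammaCoeff_pos hγ n
  have h1 := gammaCoeff_pos hγ (n + 1)
  calc gammaCoeff γ (n + 2) * gammaCoeff γ n
      = gammaCoeff γ (n + 1) *
          (gammaCoeff γ n + gammaCoeff γ n * (γ / ((n + 1 : ℕ) + 1))) := by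
        rw [gammaCoeff_succ_eq hγ (n + 1)]
        ring
    _ ≤ gammaCoeff γ (n + 1) * (gammaCoeff γ n + gammaCoeff γ n * (γ / (n + 1))) := by
        gcongr
        simp
    _ = gammaCoeff γ (n + 1) * gammaCoeff γ (n + 1) := by
        rw [← gammaCoeff_succ_eq hγ n]

/-- For `γ ≤ 1` the sequence is concave, so it stays log-concave when a constant is added. -/
theorem logConcave_gammaCoeff_add_one {γ : ℝ} (hγ : 0 < γ) (hγ1 : γ ≤ 1) (n : ℕ) :
    (gammaCoeff γ (n + 2) + 1) * (gammaCoeff γ n + 1) ≤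
      (gammaCoeff γ (n + 1) + 1) * (gammaCoeff γ (n + 1) + 1) := by
  have h := logConcave_gammaCoeff hγ n
  have h0 := gammaCoeff_pos hγ n
  have hconc : gammaCoeff γ (n + 2) - gammaCoeff γ (n + 1) ≤
      gammaCoeff γ (n + 1) - gammaCoeff γ n := by
    have h1 : gammaCoeff γ (n + 1) / (n + 2) ≤ gammaCoeff γ n / (n + 1) := by
      rw [div_le_div_iff₀ (by positivity) (by positivity), gammaCoeff_succ hγ]
      nlinarith
    have h2 := mul_le_mul_of_nonneg_left h1 hγ.le
    have e1 := gammaCoeff_succ_eq hγ (n + 1)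
    have e2 := gammaCoeff_succ_eq hγ n
    have e3 : gammaCoeff γ (n + 1) * (γ / ((n + 1 : ℕ) + 1)) =
        γ * (gammaCoeff γ (n + 1) / (n + 2)) := by
      push_cast
      ring
    have e4 : gammaCoeff γ n * (γ / (n + 1)) = γ * (gammaCoeff γ n / (n + 1)) := by ring
    linarith
  nlinarith

theorem gammaCoeff_eq_prod {γ : ℝ} (hγ : 0 < γ) (n : ℕ) :
    gammaCoeff γ n = Real.Gamma γ * (∏ j ∈ Finset.range (n + 1), (γ + j)) / n.factorial := by
  induction n with
  | zero => simp [gammaCoeff, Real.Gamma_add_one hγ.ne', mul_comm]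
  | succ n ih =>
    have h := gammaCoeff_succ hγ n
    rw [ih] at h
    have h1 : (n : ℝ) + 1 ≠ 0 := by positivity
    have h2 : (n.factorial : ℝ) ≠ 0 := by positivity
    rw [← eq_div_iff h1] at h
    rw [h, Finset.prod_range_succ _ (n + 1), Nat.factorial_succ]
    push_cast
    field_simp
    ring

theorem gammaCoeff_isEquivalent {γ : ℝ} (hγ : 0 < γ) :
    gammaCoeff γ ~[atTop] fun n : ℕ => (n : ℝ) ^ γ := by
  have hne : Real.Gamma γ ≠ 0 := (Real.Gamma_pos_of_pos hγ).ne'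
  refine (isEquivalent_iff_tendsto_one ?_).2 ?_
  · filter_upwards [eventually_gt_atTop 0] with n hn
    have : (0 : ℝ) < n := by exact_mod_cast hn
    positivity
  · have h := (tendsto_const_nhds (x := Real.Gamma γ)).div (Real.GammaSeq_tendsto_Gamma γ) hne
    rw [div_self hne] at h
    refine h.congr fun n => ?_
    simp only [Pi.div_apply]
    have h2 : (n.factorial : ℝ) ≠ 0 := by positivity
    have h3 : (∏ j ∈ Finset.range (n + 1), (γ + j)) ≠ 0 :=
      Finset.prod_ne_zero_iff.2 fun j _ => by positivity
    rw [Real.GammaSeq, gammaCoeff_eq_prod hγ]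
    field_simp

theorem ring_choose_eq {γ : ℝ} (hγ : 0 < γ) (n : ℕ) :
    Ring.choose (γ + 1 + n - 1) n * Real.Gamma (γ + 1) = gammaCoeff γ n := by
  have h := Ring.factorial_nsmul_multichoose_eq_ascPochhammer (γ + 1) n
  rw [Ring.multichoose_eq, nsmul_eq_mul, Polynomial.ascPochhammer_smeval_eq_eval] at h
  have h2 : ∀ n : ℕ, Real.Gamma (γ + n + 1) =
      (ascPochhammer ℝ n).eval (γ + 1) * Real.Gamma (γ + 1) := by
    intro n
    induction n with
    | zero => simp
    | succ n ih =>
      have hne : γ + n + 1 ≠ 0 := by positivity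
      have e : γ + ((n + 1 : ℕ) : ℝ) + 1 = γ + n + 1 + 1 := by push_cast; ring
      rw [e, Real.Gamma_add_one hne, ih, ascPochhammer_succ_eval]
      ring
  have h3 : (n.factorial : ℝ) ≠ 0 := by positivity
  rw [gammaCoeff, h2, ← h]
  field_simp

theorem hasSum_gammaCoeff {γ : ℝ} (hγ : 0 < γ) {z : ℂ} (hz : ‖z‖ < 1) :
    HasSum (fun n : ℕ => (gammaCoeff γ n : ℂ) * z ^ n)
      ((Real.Gamma (γ + 1) : ℂ) / (1 - z) ^ ((γ : ℂ) + 1)) := by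
  have h := (Complex.one_div_one_sub_cpow_hasFPowerSeriesOnBall_zero ((γ : ℂ) + 1)).hasSum
    (y := z) (by simpa [enorm_eq_nnnorm] using! hz)
  have h2 := h.mul_right (Real.Gamma (γ + 1) : ℂ)
  rw [zero_add, one_div_mul_eq_div] at h2
  refine h2.congr_fun fun n => ?_
  rw [← ring_choose_eq hγ]
  simp [Complex.ofReal_choose]
  ring

theorem hasSum_gammaCoeff_succ {γ : ℝ} (hγ : 0 < γ) {z : ℂ} (hz : ‖z‖ < 1) :
    HasSum (fun n : ℕ => (gammaCoeff γ (n + 1) : ℂ) * z ^ (n + 1))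
      ((Real.Gamma (γ + 1) : ℂ) / (1 - z) ^ ((γ : ℂ) + 1) - (Real.Gamma (γ + 1) : ℂ)) := by
  have h := (hasSum_nat_add_iff' 1).2 (hasSum_gammaCoeff hγ hz)
  simpa [gammaCoeff_zero] using h

theorem hasFPowerSeriesOnBall_of_hasSum {a : ℕ → ℂ} {f : ℂ → ℂ}
    (h : ∀ z : ℂ, ‖z‖ < 1 → HasSum (fun n => a n * z ^ n) (f z)) :
    HasFPowerSeriesOnBall f (FormalMultilinearSeries.ofScalars ℂ a) 0 1 where
  r_le := by
    refine ENNReal.le_of_forall_nnreal_lt fun r hr => ?_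
    have hr' : (r : ℝ) < 1 := by exact_mod_cast hr
    refine FormalMultilinearSeries.le_radius_of_tendsto _ (l := 0) ?_
    have h1 := (h (r : ℂ) (by simpa using hr')).summable.tendsto_atTop_zero.norm
    simpa using h1
  r_pos := one_pos
  hasSum := by
    intro y hy
    have hy' : ‖y‖ < 1 := by simpa [enorm_eq_nnnorm] using! hy
    simpa [FormalMultilinearSeries.ofScalars_apply_eq, mul_comm] using h y hy'

theorem hasAlgebraicGenFun_iff {γ : ℝ} (hγ : 0 < γ) (θ : ℕ → ℝ) :
    HasAlgebraicGenFun γ θ ↔ ∀ n : ℕ, 1 ≤ n → θ n = gammaCoeff γ n := by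
  constructor
  · intro h n hn
    obtain ⟨n, rfl⟩ : ∃ m, n = m + 1 := ⟨n - 1, by omega⟩
    let a : ℕ → ℂ := fun n => Nat.casesOn n (Real.Gamma (γ + 1) : ℂ) fun m => (θ (m + 1) : ℂ)
    have ha : ∀ z : ℂ, ‖z‖ < 1 → HasSum (fun n => a n * z ^ n)
        ((Real.Gamma (γ + 1) : ℂ) / (1 - z) ^ ((γ : ℂ) + 1)) := fun z hz => by
      rw [← hasSum_nat_add_iff' 1]
      simpa [a] using h z hz
    have h1 := (hasFPowerSeriesOnBall_of_hasSum ha).hasFPowerSeriesAt.eq_formalMultilinearSeries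
      (hasFPowerSeriesOnBall_of_hasSum fun z hz => hasSum_gammaCoeff hγ hz).hasFPowerSeriesAt
    have h2 := congrArg (fun p => p.coeff (n + 1)) h1
    simp only [FormalMultilinearSeries.coeff_ofScalars, a] at h2
    exact_mod_cast h2
  · intro h z hz
    refine (hasSum_gammaCoeff_succ hγ hz).congr_fun fun n => ?_
    rw [h _ (by omega)]

theorem sum_gammaCoeff_le {γ : ℝ} (hγ : 0 < γ) {z : ℝ} (hz : 0 ≤ z) (hz1 : z < 1) (n : ℕ) :
    ∑ j ∈ Finset.range n, gammaCoeff γ (j + 1) * z ^ (j + 1) ≤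
      Real.Gamma (γ + 1) / (1 - z) ^ (γ + 1) := by
  have h := hasSum_gammaCoeff hγ (z := (z : ℂ)) (by simpa [abs_of_nonneg hz] using hz1)
  have e : (Real.Gamma (γ + 1) : ℂ) / (1 - (z : ℂ)) ^ ((γ : ℂ) + 1) =
      ((Real.Gamma (γ + 1) / (1 - z) ^ (γ + 1) : ℝ) : ℂ) := by
    rw [Complex.ofReal_div, Complex.ofReal_cpow (by linarith)]
    push_cast
    rfl
  rw [e] at h
  have h' : HasSum (fun n => gammaCoeff γ n * z ^ n) (Real.Gamma (γ + 1) / (1 - z) ^ (γ + 1)) := by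
    exact_mod_cast h
  have hnn : ∀ n, 0 ≤ gammaCoeff γ n * z ^ n := fun n =>
    mul_nonneg (gammaCoeff_pos hγ n).le (pow_nonneg hz n)
  refine le_trans ?_ (sum_le_hasSum (Finset.range (n + 1)) (fun i _ => hnn i) h')
  rw [Finset.sum_range_succ']
  exact le_add_of_nonneg_right (hnn 0)

theorem sum_pow_succ_le {z : ℝ} (hz : 0 ≤ z) (hz1 : z < 1) (n : ℕ) :
    ∑ j ∈ Finset.range n, z ^ (j + 1) ≤ 1 / (1 - z) := by
  rw [one_div]
  refine le_trans ?_ (sum_le_hasSum (Finset.range (n + 1)) (fun i _ => pow_nonneg hz i)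
    (hasSum_geometric_of_lt_one hz hz1))
  rw [Finset.sum_range_succ']
  exact le_add_of_nonneg_right (pow_nonneg hz 0)

/-! ### Lower bounds for the ratios of the normalizations -/

theorem eventually_div_rpow_le_one {γ : ℝ} (hγ : 0 < γ) (c : ℝ) :
    ∀ᶠ n : ℕ in atTop, c / ((n : ℝ) + 1) ^ (1 / (γ + 1)) ≤ 1 := by
  have h1 : Tendsto (fun n : ℕ => (n : ℝ) + 1) atTop atTop :=
    tendsto_atTop_add_const_right _ _ tendsto_natCast_atTop_atTop
  have h2 := (tendsto_rpow_atTop (y := 1 / (γ + 1)) (by positivity)).comp h1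
  exact ((tendsto_const_nhds (x := c)).div_atTop h2).eventually (ge_mem_nhds one_pos)

/-- The lower bound for `h_m / h_{m+j}`. For `γ ≥ 1` the sequence `h` is itself log-concave. For
`γ < 1` its partial sums `H` are, and then `h_n / H_n = 1 - H_{n-1} / H_n` decreases, which gives
`h_m / h_{m+j} ≥ H_m / H_{m+j}`. -/
theorem eventually_pow_mul_le {γ : ℝ} (hγ : 0 < γ) {h : ℕ → ℝ} (hpos : ∀ n, 0 < h n)
    (hrec : ∀ n : ℕ, ((n : ℝ) + 1) * h (n + 1) =
      ∑ j ∈ Finset.range (n + 1), gammaCoeff γ (j + 1) * h (n - j))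
    {c : ℝ} (hc : 0 < c) (hGc : Real.Gamma (γ + 1) < c ^ (γ + 1)) :
    ∀ᶠ m : ℕ in atTop, 0 ≤ 1 - c / ((m : ℝ) + 1) ^ (1 / (γ + 1)) ∧
      ∀ j, (1 - c / ((m : ℝ) + 1) ^ (1 / (γ + 1))) ^ j * h (m + j) ≤ h m := by
  have hG : 0 < Real.Gamma (γ + 1) := Real.Gamma_pos_of_pos (by linarith)
  rcases le_or_gt 1 γ with h1 | h1
  · have hG1 : 1 ≤ gammaCoeff γ 0 := by
      have h2 : (2 : ℝ) ≤ γ + 1 := by linarith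
      have := Real.Gamma_strictMonoOn_Ici.monotoneOn (Set.mem_Ici.2 le_rfl) (Set.mem_Ici.2 h2) h2
      rwa [Real.Gamma_two, ← gammaCoeff_zero] at this
    have hlc := logConcave_of_recursion hG1
      (logConcave_general (gammaCoeff_pos hγ) (logConcave_gammaCoeff hγ)) hpos hrec
    have hev := eventually_le_ratio hγ hG.le le_rfl (fun n => (gammaCoeff_pos hγ n).le) hpos hlc
      hrec (d := 0) (fun z hz hz1 n => by simpa using sum_gammaCoeff_le hγ hz hz1 n) hc hGc
    filter_upwards [hev, eventually_div_rpow_le_one hγ c] with m hm hm1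
    refine ⟨by linarith, fun j => pow_mul_le (by linarith) j fun i hi => ?_⟩
    rw [← le_div_iff₀ (hpos _)]
    exact hm.trans (monotone_ratio hpos hlc hi)
  · set H : ℕ → ℝ := fun n => ∑ i ∈ Finset.range (n + 1), h i with hH
    have hHpos : ∀ n, 0 < H n := fun n =>
      Finset.sum_pos (fun i _ => hpos i) Finset.nonempty_range_add_one
    have hHrec := partialSum_recursion hrec
    have hX0 : 1 ≤ gammaCoeff γ 0 + 1 := by
      have := gammaCoeff_pos hγ 0
      linarith
    have hXpos : ∀ n, 0 < gammaCoeff γ n + 1 := fun n => by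
      have := gammaCoeff_pos hγ n
      linarith
    have hlc := logConcave_of_recursion (X := fun n => gammaCoeff γ n + 1) (H := H) hX0
      (logConcave_general hXpos (logConcave_gammaCoeff_add_one hγ h1.le)) hHpos hHrec
    have hev := eventually_le_ratio (X := fun n => gammaCoeff γ n + 1) (H := H) hγ hG.le
      zero_le_one (fun n => (hXpos n).le) hHpos hlc hHrec (fun z hz hz1 n => by
        simp only [add_mul, one_mul, Finset.sum_add_distrib]
        exact add_le_add (sum_gammaCoeff_le hγ hz hz1 n) (sum_pow_succ_le hz hz1 n)) hc hGc
    filter_upwards [hev, eventually_div_rpow_le_one hγ c, eventually_ge_atTop 1] with m hm hm1 hm0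
    refine ⟨by linarith, fun j => ?_⟩
    obtain ⟨k, rfl⟩ : ∃ k, m = k + 1 := ⟨m - 1, by omega⟩
    have hdiff : ∀ n, h (n + 1) = H (n + 1) - H n := fun n => by
      simp only [hH]
      rw [Finset.sum_range_succ _ (n + 1)]
      ring
    have h2 : (1 - c / (((k + 1 : ℕ) : ℝ) + 1) ^ (1 / (γ + 1))) ^ j * H (k + 1 + j) ≤ H (k + 1) :=
      pow_mul_le (by linarith) j fun i hi => by
        rw [← le_div_iff₀ (hHpos _)]
        exact hm.trans (monotone_ratio hHpos hlc hi)
    have h3 : h (k + 1 + j) * H (k + 1) ≤ h (k + 1) * H (k + 1 + j) := by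
      have := monotone_ratio hHpos hlc (show k ≤ k + j by omega)
      simp only at this
      rw [div_le_div_iff₀ (hHpos _) (hHpos _)] at this
      rw [show k + 1 + j = k + j + 1 by omega, hdiff, hdiff]
      linarith
    have h4 := mul_le_mul_of_nonneg_left h2 (hpos (k + 1)).le
    have h5 := mul_le_mul_of_nonneg_left h3
      (pow_nonneg (show 0 ≤ 1 - c / (((k + 1 : ℕ) : ℝ) + 1) ^ (1 / (γ + 1)) by linarith) j)
    refine le_of_mul_le_mul_right ?_ (hHpos (k + 1))
    linarith

theorem tendsto_ratio_one {γ : ℝ} (hγ : 0 < γ) {h : ℕ → ℝ} (hpos : ∀ n, 0 < h n)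
    (hrec : ∀ n : ℕ, ((n : ℝ) + 1) * h (n + 1) =
      ∑ j ∈ Finset.range (n + 1), gammaCoeff γ (j + 1) * h (n - j)) (k : ℕ) :
    Tendsto (fun n => h (n - k) / h n) atTop (𝓝 1) := by
  have hmono := monotone_of_recursion (one_le_gammaCoeff hγ) (hpos 0).le hrec
  have hG : 0 < Real.Gamma (γ + 1) := Real.Gamma_pos_of_pos (by linarith)
  obtain ⟨c, hc, hGc⟩ : ∃ c : ℝ, 0 < c ∧ Real.Gamma (γ + 1) < c ^ (γ + 1) := by
    refine ⟨Real.Gamma (γ + 1) + 1, by linarith, ?_⟩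
    have := Real.self_le_rpow_of_one_le (show 1 ≤ Real.Gamma (γ + 1) + 1 by linarith)
      (show 1 ≤ γ + 1 by linarith)
    linarith
  rw [← tendsto_add_atTop_iff_nat k]
  simp only [Nat.add_sub_cancel]
  have h1 : Tendsto (fun n : ℕ => (n : ℝ) + 1) atTop atTop :=
    tendsto_atTop_add_const_right _ _ tendsto_natCast_atTop_atTop
  have h2 := (tendsto_rpow_atTop (y := 1 / (γ + 1)) (by positivity)).comp h1
  have h3 := ((tendsto_const_nhds (x := (1 : ℝ))).sub
    ((tendsto_const_nhds (x := c)).div_atTop h2)).pow k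
  rw [sub_zero, one_pow] at h3
  refine tendsto_of_tendsto_of_tendsto_of_le_of_le' h3 tendsto_const_nhds ?_ ?_
  · filter_upwards [eventually_pow_mul_le hγ hpos hrec hc hGc] with n hn
    rw [le_div_iff₀ (hpos _)]
    exact hn.2 k
  · filter_upwards with n
    rw [div_le_one (hpos _)]
    exact hmono (by omega)

/-! ### Convergence of densities -/

/-- **Scheffé's lemma**, in the form that needs only an asymptotic lower bound for the densities. -/
theorem tendsto_integral_abs_sub_of_liminf {α : Type*} [MeasurableSpace α] {μ : Measure α}
    {f : α → ℝ} {F : ℕ → α → ℝ} (hf : Integrable f μ) (hf0 : ∀ᵐ x ∂μ, 0 ≤ f x)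
    (hF : ∀ᶠ n in atTop, Integrable (F n) μ) (hF0 : ∀ n x, 0 ≤ F n x)
    (hint : ∀ᶠ n in atTop, ∫ x, F n x ∂μ = ∫ x, f x ∂μ)
    (hlim : ∀ᵐ x ∂μ, ∀ ε > 0, ∀ᶠ n in atTop, f x - ε ≤ F n x) :
    Tendsto (fun n => ∫ x, |F n x - f x| ∂μ) atTop (𝓝 0) := by
  have h1 : Tendsto (fun n => ∫ x, max (f x - F n x) 0 ∂μ) atTop (𝓝 (∫ _, (0 : ℝ) ∂μ)) := by
    refine tendsto_integral_filter_of_dominated_convergence f ?_ ?_ hf ?_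
    · filter_upwards [hF] with n hn
      exact ((hf.sub hn).sup (integrable_zero _ _ _)).aestronglyMeasurable
    · filter_upwards with n
      filter_upwards [hf0] with x hx
      rw [Real.norm_of_nonneg (le_max_right _ _)]
      exact max_le (by linarith [hF0 n x]) hx
    · filter_upwards [hlim] with x hx
      refine tendsto_order.2 ⟨fun b hb => Eventually.of_forall fun n => hb.trans_le
        (le_max_right _ _), fun b hb => ?_⟩
      filter_upwards [hx (b / 2) (by linarith)] with n hn
      exact max_lt (by linarith) hb
  rw [integral_zero] at h1
  have h2 := h1.const_mul 2
  rw [mul_zero] at h2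
  refine h2.congr' ?_
  filter_upwards [hF, hint] with n hn hi
  have h3 : ∀ x, |F n x - f x| = 2 * max (f x - F n x) 0 - (f x - F n x) := fun x => by
    rcases le_total (F n x) (f x) with h | h
    · rw [max_eq_left (by linarith), abs_of_nonpos (by linarith)]
      ring
    · rw [max_eq_right (by linarith), abs_of_nonneg (by linarith)]
      ring
  simp only [h3]
  have i1 : Integrable (fun x => max (f x - F n x) 0) μ :=
    (hf.sub hn).sup (integrable_zero _ _ _)
  have i2 : Integrable (fun x => f x - F n x) μ := hf.sub hn
  rw [integral_sub (i1.const_mul 2) i2, integral_sub hf hn, hi, integral_const_mul]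
  simp

/-- Convergence of densities in `L¹` passes to integrals of bounded, almost everywhere convergent
test functions. -/
theorem tendsto_integral_mul_of_tendsto_integral_abs_sub {α : Type*} [MeasurableSpace α]
    {μ : Measure α} {f φ : α → ℝ} {F Φ : ℕ → α → ℝ} {M : ℝ} (hf : Integrable f μ)
    (hF : ∀ᶠ n in atTop, Integrable (F n) μ) (hΦ : ∀ n, AEStronglyMeasurable (Φ n) μ)
    (hM : ∀ n x, |Φ n x| ≤ M) (hlim : ∀ᵐ x ∂μ, Tendsto (fun n => Φ n x) atTop (𝓝 (φ x)))
    (hL1 : Tendsto (fun n => ∫ x, |F n x - f x| ∂μ) atTop (𝓝 0)) :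
    Tendsto (fun n => ∫ x, Φ n x * F n x ∂μ) atTop (𝓝 (∫ x, φ x * f x ∂μ)) := by
  have h1 : Tendsto (fun n => ∫ x, Φ n x * f x ∂μ) atTop (𝓝 (∫ x, φ x * f x ∂μ)) := by
    refine tendsto_integral_of_dominated_convergence (fun x => M * |f x|)
      (fun n => (hΦ n).mul hf.aestronglyMeasurable) (hf.abs.const_mul M) (fun n => ?_) ?_
    · filter_upwards with x
      rw [norm_mul, Real.norm_eq_abs, Real.norm_eq_abs]
      exact mul_le_mul_of_nonneg_right (hM n x) (abs_nonneg _)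
    · filter_upwards [hlim] with x hx
      exact hx.mul_const _
  have h2 : Tendsto (fun n => ∫ x, Φ n x * F n x ∂μ - ∫ x, Φ n x * f x ∂μ) atTop (𝓝 0) := by
    have h3 := hL1.const_mul M
    rw [mul_zero] at h3
    refine squeeze_zero_norm' ?_ h3
    filter_upwards [hF] with n hn
    have i1 : Integrable (fun x => Φ n x * F n x) μ := hn.bdd_mul (hΦ n) (c := M)
      (Eventually.of_forall fun x => hM n x)
    have i2 : Integrable (fun x => Φ n x * f x) μ := hf.bdd_mul (hΦ n) (c := M)
      (Eventually.of_forall fun x => hM n x)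
    rw [← integral_sub i1 i2, ← integral_const_mul]
    refine norm_integral_le_of_norm_le ((hn.sub hf).abs.const_mul M) ?_
    filter_upwards with x
    rw [← mul_sub, norm_mul, Real.norm_eq_abs, Real.norm_eq_abs]
    exact mul_le_mul_of_nonneg_right (hM n x) (abs_nonneg _)
  simpa using h2.add h1

/-- The integral of a step function on the grid of width `1 / N`. -/
theorem integral_comp_floor {N : ℝ} (hN : 0 < N) (K : ℕ) (ψ : ℕ → ℝ) (hψ : ∀ k, K ≤ k → ψ k = 0) :
    IntegrableOn (fun x : ℝ => ψ ⌊x * N⌋₊) (Set.Ioi 0) ∧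
      ∫ x in Set.Ioi (0 : ℝ), ψ ⌊x * N⌋₊ = (∑ k ∈ Finset.range K, ψ k) / N := by
  rw [← integrableOn_Ici_iff_integrableOn_Ioi, ← integral_Ici_eq_integral_Ioi]
  have h1 : ∀ x ∈ Set.Ici (0 : ℝ), ψ ⌊x * N⌋₊ = ∑ k ∈ Finset.range K,
      (Set.Ico (k / N) ((k + 1) / N)).indicator (fun _ => ψ k) x := by
    intro x hx
    have hmem : ∀ k : ℕ, x ∈ Set.Ico (k / N) ((k + 1) / N) ↔ ⌊x * N⌋₊ = k := fun k => by
      rw [Nat.floor_eq_iff (mul_nonneg hx hN.le), Set.mem_Ico, div_le_iff₀ hN, lt_div_iff₀ hN]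
    simp only [Set.indicator_apply, hmem, Finset.sum_ite_eq, Finset.mem_range]
    split_ifs with h
    · rfl
    · exact hψ _ (by omega)
  have hvol : ∀ k : ℕ, (volume.restrict (Set.Ici (0 : ℝ))).real
      (Set.Ico (k / N) ((k + 1) / N)) = 1 / N := fun k => by
    have hk : (0 : ℝ) ≤ k / N := by positivity
    have hsub : Set.Ico (k / N) ((k + 1) / N) ⊆ Set.Ici (0 : ℝ) := fun x hx => hk.trans hx.1
    rw [measureReal_restrict_apply measurableSet_Ico, Set.inter_eq_left.2 hsub,
      Real.volume_real_Ico_of_le (by gcongr; linarith)]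
    field_simp
    ring
  have hint : ∀ k ∈ Finset.range K, Integrable
      ((Set.Ico (k / N) ((k + 1) / N)).indicator fun _ => ψ k)
      (volume.restrict (Set.Ici (0 : ℝ))) := fun k _ =>
    ((integrableOn_const (by simp)).integrable_indicator measurableSet_Ico).restrict
  constructor
  · exact (integrableOn_congr_fun h1 measurableSet_Ici).2 (integrable_finsetSum _ hint)
  · rw [setIntegral_congr_fun measurableSet_Ici h1, integral_finsetSum _ hint, Finset.sum_div]
    refine Finset.sum_congr rfl fun k _ => ?_
    rw [integral_indicator_const _ measurableSet_Ico, hvol, smul_eq_mul]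
    ring

/-! ### The limit density -/

/-- The density `x ^ γ e ^ (-a x)` of the Gamma law with shape `γ + 1` and rate `a`, on `x > 0`. Its
normalizing constant `a ^ (γ + 1) / Γ(γ + 1)` equals `1`. -/
noncomputable def limitDensity (γ x : ℝ) : ℝ :=
  x ^ γ * Real.exp (-(Real.Gamma (γ + 1) ^ (1 / (γ + 1))) * x)

theorem rate_pos {γ : ℝ} (hγ : 0 < γ) : 0 < Real.Gamma (γ + 1) ^ (1 / (γ + 1)) :=
  Real.rpow_pos_of_pos (Real.Gamma_pos_of_pos (by linarith)) _

theorem rate_rpow {γ : ℝ} (hγ : 0 < γ) :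
    (Real.Gamma (γ + 1) ^ (1 / (γ + 1))) ^ (γ + 1) = Real.Gamma (γ + 1) := by
  rw [← Real.rpow_mul (Real.Gamma_pos_of_pos (by linarith)).le,
    one_div_mul_cancel (by linarith), Real.rpow_one]

theorem limitDensity_nonneg (γ : ℝ) {x : ℝ} (hx : 0 ≤ x) : 0 ≤ limitDensity γ x :=
  mul_nonneg (Real.rpow_nonneg hx _) (Real.exp_pos _).le

theorem integral_limitDensity {γ : ℝ} (hγ : 0 < γ) :
    ∫ x in Set.Ioi 0, limitDensity γ x = 1 := by
  have h := Real.integral_rpow_mul_exp_neg_mul_Ioi (a := γ + 1) (by linarith) (rate_pos hγ)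
  have hG := Real.Gamma_pos_of_pos (show 0 < γ + 1 by linarith)
  rw [add_sub_cancel_right, Real.div_rpow zero_le_one (rate_pos hγ).le, Real.one_rpow,
    rate_rpow hγ, one_div_mul_cancel hG.ne'] at h
  simpa [limitDensity] using h

theorem integrable_limitDensity {γ : ℝ} (hγ : 0 < γ) :
    IntegrableOn (limitDensity γ) (Set.Ioi 0) := by
  by_contra h
  have := integral_limitDensity hγ
  rw [integral_undef h] at this
  exact zero_ne_one this

/-- The scale `n ^ (1 / (γ + 1))` of the first cycle length. -/
noncomputable def cycleScale (γ : ℝ) (n : ℕ) : ℝ := (n : ℝ) ^ (1 / (γ + 1))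

theorem cycleScale_pos (γ : ℝ) {n : ℕ} (hn : 1 ≤ n) : 0 < cycleScale γ n :=
  Real.rpow_pos_of_pos (by exact_mod_cast hn) _

theorem cycleScale_rpow {γ : ℝ} (hγ : 0 < γ) (n : ℕ) : cycleScale γ n ^ (γ + 1) = n := by
  rw [cycleScale, ← Real.rpow_mul n.cast_nonneg, one_div_mul_cancel (by linarith), Real.rpow_one]

theorem cycleScale_rpow' {γ : ℝ} (hγ : 0 < γ) {n : ℕ} (hn : 1 ≤ n) :
    cycleScale γ n ^ γ = n / cycleScale γ n := by
  have h := cycleScale_rpow hγ n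
  rw [Real.rpow_add_one (cycleScale_pos γ hn).ne'] at h
  rw [eq_div_iff (cycleScale_pos γ hn).ne', h]

theorem tendsto_cycleScale {γ : ℝ} (hγ : 0 < γ) : Tendsto (cycleScale γ) atTop atTop :=
  (tendsto_rpow_atTop (by positivity)).comp tendsto_natCast_atTop_atTop

/-- The number, counted from `1`, of the cell that contains `x ≥ 0` in the grid of width
`1 / cycleScale γ n`. Its right end is `cellIndex γ n x / cycleScale γ n`. -/
noncomputable def cellIndex (γ : ℝ) (n : ℕ) (x : ℝ) : ℕ := ⌊x * cycleScale γ n⌋₊ + 1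

theorem tendsto_cellIndex_div {γ : ℝ} (hγ : 0 < γ) {x : ℝ} (hx : 0 ≤ x) :
    Tendsto (fun n => (cellIndex γ n x : ℝ) / cycleScale γ n) atTop (𝓝 x) := by
  have h1 := (tendsto_nat_floor_mul_div_atTop hx).comp (tendsto_cycleScale hγ)
  have h2 := h1.add ((tendsto_const_nhds (x := (1 : ℝ))).div_atTop (tendsto_cycleScale hγ))
  rw [add_zero] at h2
  refine h2.congr fun n => ?_
  simp only [Function.comp, cellIndex]
  push_cast
  ring

/-- The density of the piecewise constant smoothing of the rescaled first cycle length. -/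
noncomputable def stepDensity (γ : ℝ) (θ : ℕ → ℝ) (n : ℕ) (x : ℝ) : ℝ :=
  cycleScale γ n * firstCycleMass θ n (cellIndex γ n x)

theorem integral_mul_stepDensity {γ : ℝ} {θ : ℕ → ℝ} {n : ℕ} (hn : 1 ≤ n)
    (φ : ℝ → ℝ) :
    IntegrableOn (fun x => φ (cellIndex γ n x / cycleScale γ n) * stepDensity γ θ n x)
      (Set.Ioi 0) ∧
    ∫ x in Set.Ioi 0, φ (cellIndex γ n x / cycleScale γ n) * stepDensity γ θ n x =
      ∑ j ∈ Finset.Icc 1 n, φ (j / cycleScale γ n) * firstCycleMass θ n j := by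
  have hN := cycleScale_pos γ hn
  have h := integral_comp_floor hN n (fun k => φ ((k + 1 : ℕ) / cycleScale γ n) *
    (cycleScale γ n * firstCycleMass θ n (k + 1))) fun k hk => by
      rw [firstCycleMass, if_neg (by omega)]
      simp
  refine ⟨h.1, h.2.trans ?_⟩
  rw [← Finset.Ico_add_one_right_eq_Icc, Finset.sum_Ico_eq_sum_range, Finset.sum_div,
    Nat.add_sub_cancel]
  refine Finset.sum_congr rfl fun k _ => ?_
  rw [add_comm k 1]
  field_simp

theorem exp_le_one_sub_pow {w : ℝ} (hw1 : w < 1) (j : ℕ) :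
    Real.exp (-(j * w / (1 - w))) ≤ (1 - w) ^ j := by
  have h1 : 0 < 1 - w := by linarith
  have h2 := Real.add_one_le_exp (w / (1 - w))
  have h3 : w / (1 - w) + 1 = (1 - w)⁻¹ := by field_simp; ring
  rw [h3] at h2
  have h4 : Real.exp (-(w / (1 - w))) ≤ 1 - w := by
    rw [Real.exp_neg]
    exact inv_le_of_inv_le₀ h1 h2
  have h5 : -(j * w / (1 - w)) = j * (-(w / (1 - w))) := by ring
  rw [h5, Real.exp_nat_mul]
  gcongr

theorem recursion_of_eq_gammaCoeff {γ : ℝ} {θ : ℕ → ℝ}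
    (hθ : ∀ n, 1 ≤ n → θ n = gammaCoeff γ n) (n : ℕ) :
    ((n : ℝ) + 1) * partitionFunction θ (n + 1) =
      ∑ j ∈ Finset.range (n + 1), gammaCoeff γ (j + 1) * partitionFunction θ (n - j) := by
  have h := mul_partitionFunction θ (n + 1)
  rw [← Finset.Ico_add_one_right_eq_Icc, Finset.sum_Ico_eq_sum_range, Nat.add_sub_cancel] at h
  push_cast at h
  rw [h]
  refine Finset.sum_congr rfl fun j _ => ?_
  rw [hθ _ (by omega), add_comm 1 j, Nat.add_sub_add_right]

theorem tendsto_cellIndex {γ : ℝ} (hγ : 0 < γ) {x : ℝ} (hx : 0 < x) :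
    Tendsto (fun n => cellIndex γ n x) atTop atTop :=
  tendsto_atTop_mono (fun _ => Nat.le_succ _)
    (tendsto_nat_floor_atTop.comp ((tendsto_cycleScale hγ).const_mul_atTop hx))

theorem tendsto_cellIndex_div_self {γ : ℝ} (hγ : 0 < γ) {x : ℝ} (hx : 0 < x) :
    Tendsto (fun n => (cellIndex γ n x : ℝ) / n) atTop (𝓝 0) := by
  have h1 := (tendsto_cellIndex_div hγ hx.le).div_atTop
    ((tendsto_rpow_atTop hγ).comp (tendsto_cycleScale hγ))
  refine h1.congr' ?_
  filter_upwards [eventually_ge_atTop 1] with n hn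
  have hN := cycleScale_pos γ hn
  have hn' : (0 : ℝ) < n := by exact_mod_cast hn
  simp only [Function.comp]
  rw [cycleScale_rpow' hγ hn]
  field_simp

/-- With `w = c / (n - j + 1) ^ (1 / (γ + 1))` and `j` the cell index of `x`, so that `j` is close
to `x n ^ (1 / (γ + 1))`, one has `w → 0` and `j w → c x`. -/
theorem tendsto_exp_cellIndex {γ : ℝ} (hγ : 0 < γ) {x c : ℝ} (hx : 0 < x) :
    Tendsto (fun n : ℕ => c / (((n - cellIndex γ n x : ℕ) : ℝ) + 1) ^ (1 / (γ + 1)))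
      atTop (𝓝 0) ∧
    Tendsto (fun n : ℕ => cellIndex γ n x *
      (c / (((n - cellIndex γ n x : ℕ) : ℝ) + 1) ^ (1 / (γ + 1)))) atTop (𝓝 (c * x)) := by
  have hev : ∀ᶠ n : ℕ in atTop, cellIndex γ n x ≤ n := by
    filter_upwards [(tendsto_cellIndex_div_self hγ hx).eventually (ge_mem_nhds one_pos),
      eventually_ge_atTop 1] with n hn hn1
    have hn' : (0 : ℝ) < n := by exact_mod_cast hn1
    rw [div_le_one hn'] at hn
    exact_mod_cast hn
  have h1 : Tendsto (fun n : ℕ => (((n - cellIndex γ n x : ℕ) : ℝ) + 1) / n) atTop (𝓝 1) := by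
    have h2 := ((tendsto_const_nhds (x := (1 : ℝ))).sub (tendsto_cellIndex_div_self hγ hx)).add
      (tendsto_const_nhds.div_atTop tendsto_natCast_atTop_atTop : Tendsto (fun n : ℕ =>
        (1 : ℝ) / n) atTop (𝓝 0))
    rw [sub_zero, add_zero] at h2
    refine h2.congr' ?_
    filter_upwards [hev, eventually_ge_atTop 1] with n hn hn1
    have hn' : (0 : ℝ) < n := by exact_mod_cast hn1
    rw [Nat.cast_sub hn]
    field_simp
  have h3 : Tendsto (fun n : ℕ =>
      cycleScale γ n * (c / (((n - cellIndex γ n x : ℕ) : ℝ) + 1) ^ (1 / (γ + 1))))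
      atTop (𝓝 c) := by
    have h4 := (tendsto_const_nhds (x := c)).div
      (h1.rpow_const (p := 1 / (γ + 1)) (Or.inl one_ne_zero)) (by simp)
    rw [Real.one_rpow, div_one] at h4
    refine h4.congr' ?_
    filter_upwards [eventually_ge_atTop 1] with n hn
    have hn' : (0 : ℝ) < n := by exact_mod_cast hn
    simp only [Pi.div_apply]
    rw [Real.div_rpow (by positivity) hn'.le, cycleScale]
    field_simp
  constructor
  · refine (h3.div_atTop (tendsto_cycleScale hγ)).congr' ?_
    filter_upwards [eventually_ge_atTop 1] with n hn
    have hN := cycleScale_pos γ hn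
    field_simp
  · have h5 := h3.mul (tendsto_cellIndex_div hγ hx.le)
    refine h5.congr' ?_
    filter_upwards [eventually_ge_atTop 1] with n hn
    have hN := cycleScale_pos γ hn
    field_simp

theorem tendsto_gammaCoeff_cellIndex {γ : ℝ} (hγ : 0 < γ) {x : ℝ} (hx : 0 < x) :
    Tendsto (fun n : ℕ => cycleScale γ n * gammaCoeff γ (cellIndex γ n x) / n) atTop
      (𝓝 (x ^ γ)) := by
  have h1 : Tendsto (fun j : ℕ => gammaCoeff γ j / (j : ℝ) ^ γ) atTop (𝓝 1) := by
    refine (isEquivalent_iff_tendsto_one ?_).1 (gammaCoeff_isEquivalent hγ)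
    filter_upwards [eventually_gt_atTop 0] with n hn
    have : (0 : ℝ) < n := by exact_mod_cast hn
    positivity
  have h2 := (h1.comp (tendsto_cellIndex hγ hx)).mul
    ((tendsto_cellIndex_div hγ hx.le).rpow_const (p := γ) (Or.inl hx.ne'))
  rw [one_mul] at h2
  refine h2.congr' ?_
  filter_upwards [eventually_ge_atTop 1] with n hn
  have hN := cycleScale_pos γ hn
  have hn' : (0 : ℝ) < n := by exact_mod_cast hn
  have hj : (0 : ℝ) < cellIndex γ n x := by rw [cellIndex]; positivity
  have hj' : (0 : ℝ) < (cellIndex γ n x : ℝ) ^ γ := by positivity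
  simp only [Function.comp]
  rw [Real.div_rpow hj.le hN.le, cycleScale_rpow' hγ hn]
  field_simp

/-- The densities are asymptotically at least the limit density: the ratio bound holds for every
`c > a`, and `c` is taken so close to `a` that `e ^ (-c x)` loses less than `ε`. -/
theorem eventually_le_stepDensity {γ : ℝ} (hγ : 0 < γ) {θ : ℕ → ℝ}
    (hθ : ∀ n, 1 ≤ n → θ n = gammaCoeff γ n) {x : ℝ} (hx : 0 < x) {ε : ℝ} (hε : 0 < ε) :
    ∀ᶠ n in atTop, limitDensity γ x - ε ≤ stepDensity γ θ n x := by
  have hθpos : ∀ j, 1 ≤ j → 0 < θ j := fun j hj => hθ j hj ▸ gammaCoeff_pos hγ j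
  set a := Real.Gamma (γ + 1) ^ (1 / (γ + 1)) with ha
  obtain ⟨c, hac, hc⟩ : ∃ c, a < c ∧ limitDensity γ x - ε < x ^ γ * Real.exp (-(c * x)) := by
    have hcont : Tendsto (fun c => x ^ γ * Real.exp (-(c * x))) (𝓝[>] a)
        (𝓝 (x ^ γ * Real.exp (-(a * x)))) :=
      (Continuous.tendsto (by fun_prop) a).mono_left nhdsWithin_le_nhds
    have hlt : limitDensity γ x - ε < x ^ γ * Real.exp (-(a * x)) := by
      rw [limitDensity, ← ha, neg_mul]
      linarith
    exact (((hcont.eventually (lt_mem_nhds hlt)).and self_mem_nhdsWithin).exists).imp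
      fun c h => ⟨h.2, h.1⟩
  have hc0 : 0 < c := (rate_pos hγ).trans hac
  have hGc : Real.Gamma (γ + 1) < c ^ (γ + 1) := by
    rw [← rate_rpow hγ]
    exact Real.rpow_lt_rpow (rate_pos hγ).le hac (by linarith)
  obtain ⟨hw0, hwj⟩ := tendsto_exp_cellIndex hγ (c := c) hx
  have hlim : Tendsto (fun n : ℕ => cycleScale γ n * gammaCoeff γ (cellIndex γ n x) / n *
      Real.exp (-(cellIndex γ n x * (c / (((n - cellIndex γ n x : ℕ) : ℝ) + 1) ^ (1 / (γ + 1))) /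
        (1 - c / (((n - cellIndex γ n x : ℕ) : ℝ) + 1) ^ (1 / (γ + 1))))))
      atTop (𝓝 (x ^ γ * Real.exp (-(c * x)))) := by
    refine (tendsto_gammaCoeff_cellIndex hγ hx).mul ?_
    have h1 := (hwj.div ((tendsto_const_nhds (x := (1 : ℝ))).sub hw0) (by simp)).neg
    rw [sub_zero, div_one] at h1
    exact (Real.continuous_exp.tendsto _).comp h1
  have hrec := recursion_of_eq_gammaCoeff hθ
  have hev : ∀ᶠ n : ℕ in atTop, cellIndex γ n x < n := by
    filter_upwards [(tendsto_cellIndex_div_self hγ hx).eventually (gt_mem_nhds one_pos),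
      eventually_ge_atTop 1] with n hn hn1
    have hn' : (0 : ℝ) < n := by exact_mod_cast hn1
    rw [div_lt_one hn'] at hn
    exact_mod_cast hn
  have hsub : Tendsto (fun n : ℕ => n - cellIndex γ n x) atTop atTop := by
    have h1 : Tendsto (fun n : ℕ => (n : ℝ) * (1 - cellIndex γ n x / n)) atTop atTop :=
      tendsto_natCast_atTop_atTop.atTop_mul_pos one_pos
        (by simpa using (tendsto_const_nhds (x := (1 : ℝ))).sub (tendsto_cellIndex_div_self hγ hx))
    rw [← tendsto_natCast_atTop_iff (R := ℝ)]
    refine h1.congr' ?_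
    filter_upwards [hev, eventually_ge_atTop 1] with n hn hn1
    have hn' : (0 : ℝ) < n := by exact_mod_cast hn1
    rw [Nat.cast_sub hn.le]
    field_simp
  filter_upwards [hlim.eventually (lt_mem_nhds hc), hev, hw0.eventually (gt_mem_nhds one_pos),
    hsub.eventually (eventually_pow_mul_le hγ (partitionFunction_pos hθpos) hrec hc0 hGc),
    eventually_ge_atTop 1] with n h1 h2 h3 h4 hn
  have hN := cycleScale_pos γ hn
  have hn' : (0 : ℝ) < n := by exact_mod_cast hn
  have hj1 : 1 ≤ cellIndex γ n x := by rw [cellIndex]; omega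
  have h5 := h4.2 (cellIndex γ n x)
  rw [Nat.sub_add_cancel h2.le] at h5
  have h6 := exp_le_one_sub_pow h3 (cellIndex γ n x)
  have hh := partitionFunction_pos hθpos n
  have h7 := (mul_le_mul_of_nonneg_right h6 hh.le).trans h5
  rw [← le_div_iff₀ hh] at h7
  have hg := gammaCoeff_pos hγ (cellIndex γ n x)
  refine h1.le.trans ((mul_le_mul_of_nonneg_left h7 (by positivity)).trans_eq ?_)
  rw [stepDensity, firstCycleMass, if_pos ⟨hj1, h2.le⟩, hθ _ hj1]
  field_simp

/-- The rescaled first cycle length, tested against a bounded almost everywhere continuous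
function. -/
theorem tendsto_sum_firstCycleMass {γ : ℝ} (hγ : 0 < γ) {θ : ℕ → ℝ}
    (hθ : ∀ n, 1 ≤ n → θ n = gammaCoeff γ n) {φ : ℝ → ℝ} {M : ℝ} (hM : ∀ x, |φ x| ≤ M)
    (hφ : ∀ᵐ x ∂(volume.restrict (Set.Ioi (0 : ℝ))), ContinuousAt φ x) :
    Tendsto (fun n => ∑ j ∈ Finset.Icc 1 n, φ (j / cycleScale γ n) * firstCycleMass θ n j) atTop
      (𝓝 (∫ x in Set.Ioi 0, φ x * limitDensity γ x)) := by
  have hθpos : ∀ j, 1 ≤ j → 0 < θ j := fun j hj => hθ j hj ▸ gammaCoeff_pos hγ j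
  have hpos : ∀ᵐ x ∂(volume.restrict (Set.Ioi (0 : ℝ))), 0 < x :=
    ae_restrict_mem measurableSet_Ioi
  have hint : ∀ᶠ n in atTop, IntegrableOn (stepDensity γ θ n) (Set.Ioi 0) := by
    filter_upwards [eventually_ge_atTop 1] with n hn
    simpa using (integral_mul_stepDensity (γ := γ) (θ := θ) hn fun _ => 1).1
  have hL1 : Tendsto (fun n => ∫ x in Set.Ioi 0, |stepDensity γ θ n x - limitDensity γ x|)
      atTop (𝓝 0) := by
    refine tendsto_integral_abs_sub_of_liminf (integrable_limitDensity hγ) ?_ hint ?_ ?_ ?_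
    · filter_upwards [hpos] with x hx using limitDensity_nonneg γ hx.le
    · intro n x
      exact mul_nonneg (Real.rpow_nonneg n.cast_nonneg _) (firstCycleMass_nonneg hθpos _ _)
    · filter_upwards [eventually_ge_atTop 1] with n hn
      have h := (integral_mul_stepDensity (γ := γ) (θ := θ) hn fun _ => 1).2
      simp only [one_mul] at h
      rw [h, sum_firstCycleMass hθpos hn, integral_limitDensity hγ]
    · filter_upwards [hpos] with x hx ε hε using eventually_le_stepDensity hγ hθ hx hε
  have h := tendsto_integral_mul_of_tendsto_integral_abs_sub (φ := φ)
    (Φ := fun n x => φ (cellIndex γ n x / cycleScale γ n)) (integrable_limitDensity hγ) hint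
    (fun n => by
      have h1 : Measurable fun x : ℝ => ⌊x * cycleScale γ n⌋₊ :=
        Nat.measurable_floor.comp (measurable_id.mul_const _)
      have h2 : Measurable fun k : ℕ => φ ((k + 1 : ℕ) / cycleScale γ n) := measurable_from_top
      exact (h2.comp h1).aestronglyMeasurable)
    (fun n x => hM _) (by
      filter_upwards [hpos, hφ] with x hx hc
      exact hc.tendsto.comp (tendsto_cellIndex_div hγ hx.le)) hL1
  refine h.congr' ?_
  filter_upwards [eventually_ge_atTop 1] with n hn
  exact (integral_mul_stepDensity hn φ).2

/-! ### The first cycle length and the number of cycles -/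

theorem measurable_perm {n : ℕ} {E : Type*} [MeasurableSpace E] (f : Equiv.Perm (Fin n) → E) :
    Measurable f := measurable_from_top

theorem tendsto_integral_firstCycleLength {γ : ℝ} (hγ : 0 < γ) {θ : ℕ → ℝ}
    (hθ : ∀ n, 1 ≤ n → θ n = gammaCoeff γ n) {φ : ℝ → ℝ} {M : ℝ} (hM : ∀ x, |φ x| ≤ M)
    (hφ : ∀ᵐ x ∂(volume.restrict (Set.Ioi (0 : ℝ))), ContinuousAt φ x) :
    Tendsto (fun n => ∫ σ, φ (firstCycleLength σ / cycleScale γ n) ∂(permLaw θ n)) atTop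
      (𝓝 (∫ x in Set.Ioi 0, φ x * limitDensity γ x)) := by
  have hθpos : ∀ j, 1 ≤ j → 0 < θ j := fun j hj => hθ j hj ▸ gammaCoeff_pos hγ j
  refine (tendsto_sum_firstCycleMass hγ hθ hM hφ).congr' ?_
  filter_upwards [eventually_ge_atTop 1] with n hn
  exact (integral_firstCycleLength hθpos hn fun j => φ (j / cycleScale γ n)).symm

theorem tendsto_firstCycleLength_lt {γ : ℝ} (hγ : 0 < γ) {θ : ℕ → ℝ}
    (hθ : ∀ n, 1 ≤ n → θ n = gammaCoeff γ n) {s : ℝ} (hs : 0 ≤ s) :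
    Tendsto (fun n => (permLaw θ n).real {σ | (firstCycleLength σ : ℝ) / cycleScale γ n < s}) atTop
      (𝓝 (∫ x in (0 : ℝ)..s, limitDensity γ x)) := by
  have h := tendsto_integral_firstCycleLength hγ hθ (φ := (Set.Iio s).indicator 1) (M := 1)
    (fun x => by
      by_cases hx : x ∈ Set.Iio s <;> simp [hx])
    (by
      refine ae_restrict_of_ae ?_
      filter_upwards [Measure.ae_ne volume s] with x hx
      rcases hx.lt_or_gt with hx | hx
      · refine (continuousAt_const (y := (1 : ℝ))).congr ?_
        filter_upwards [gt_mem_nhds hx] with y hy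
        simp [hy]
      · refine (continuousAt_const (y := (0 : ℝ))).congr ?_
        filter_upwards [lt_mem_nhds hx] with y hy
        simp [hy.le])
  have e1 : ∫ x in Set.Ioi 0, (Set.Iio s).indicator 1 x * limitDensity γ x =
      ∫ x in (0 : ℝ)..s, limitDensity γ x := by
    have h1 : ∀ x, (Set.Iio s).indicator 1 x * limitDensity γ x =
        (Set.Iio s).indicator (limitDensity γ) x := fun x => by
      by_cases hx : x < s <;> simp [hx]
    simp only [h1]
    rw [setIntegral_indicator measurableSet_Iio, Set.Ioi_inter_Iio,
      intervalIntegral.integral_of_le hs, integral_Ioc_eq_integral_Ioo]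
  rw [e1] at h
  refine h.congr fun n => ?_
  rw [← integral_indicator_one (measurableSet_setOfPred.2 (measurable_perm _))]
  rfl

theorem integral_gammaMeasure {γ : ℝ} (hγ : 0 < γ) (φ : ℝ → ℝ) :
    ∫ x, φ x ∂(gammaMeasure (γ + 1) (Real.Gamma (γ + 1) ^ (1 / (γ + 1)))) =
      ∫ x in Set.Ioi 0, φ x * limitDensity γ x := by
  have ha := rate_pos hγ
  have hG := Real.Gamma_pos_of_pos (show 0 < γ + 1 by linarith)
  have hpdf : ∀ x, gammaPDFReal (γ + 1) (Real.Gamma (γ + 1) ^ (1 / (γ + 1))) x =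
      (Set.Ici 0).indicator (limitDensity γ) x := fun x => by
    by_cases hx : 0 ≤ x
    · rw [Set.indicator_of_mem (Set.mem_Ici.2 hx), gammaPDFReal, if_pos hx, rate_rpow hγ,
        div_self hG.ne', one_mul, add_sub_cancel_right, limitDensity, neg_mul]
    · rw [Set.indicator_of_notMem (by simpa using hx), gammaPDFReal, if_neg hx]
  have hmeas : Measurable (gammaPDF (γ + 1) (Real.Gamma (γ + 1) ^ (1 / (γ + 1)))) :=
    (measurable_gammaPDFReal _ _).ennreal_ofReal
  rw [gammaMeasure, integral_withDensity_eq_integral_toReal_smul hmeas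
    (Eventually.of_forall fun x => ENNReal.ofReal_lt_top), ← integral_Ici_eq_integral_Ioi,
    ← integral_indicator measurableSet_Ici]
  refine integral_congr_ae (Eventually.of_forall fun x => ?_)
  simp only [gammaPDF]
  rw [ENNReal.toReal_ofReal (gammaPDFReal_nonneg (by linarith) ha x), hpdf, smul_eq_mul]
  by_cases hx : 0 ≤ x
  · simp [hx, mul_comm]
  · simp [hx]

theorem tendstoInDistribution_firstCycleLength {γ : ℝ} (hγ : 0 < γ) {θ : ℕ → ℝ}
    (hθ : ∀ n, 1 ≤ n → θ n = gammaCoeff γ n) [∀ n, IsProbabilityMeasure (permLaw θ n)]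
    [IsProbabilityMeasure (gammaMeasure (γ + 1) (Real.Gamma (γ + 1) ^ (1 / (γ + 1))))] :
    TendstoInDistribution
      (fun (n : ℕ) (σ : Equiv.Perm (Fin n)) => (firstCycleLength σ : ℝ) / cycleScale γ n)
      atTop (fun x : ℝ => x) (fun n => permLaw θ n)
      (gammaMeasure (γ + 1) (Real.Gamma (γ + 1) ^ (1 / (γ + 1)))) where
  forall_aemeasurable n := (measurable_perm _).aemeasurable
  aemeasurable_limit := aemeasurable_id
  tendsto := by
    refine ProbabilityMeasure.tendsto_iff_forall_integral_tendsto.2 fun φ => ?_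
    have h := tendsto_integral_firstCycleLength hγ hθ (φ := φ) (M := ‖φ‖)
      (fun x => φ.norm_coe_le_norm x) (Eventually.of_forall fun x => φ.continuous.continuousAt)
    rw [← integral_gammaMeasure hγ] at h
    simp only [ProbabilityMeasure.coe_mk]
    rw [Measure.map_id']
    refine h.congr fun n => ?_
    rw [integral_map (measurable_perm _).aemeasurable φ.continuous.aestronglyMeasurable]

theorem integral_inv_mul_limitDensity {γ : ℝ} (hγ : 0 < γ) :
    ∫ x in Set.Ioi 0, x⁻¹ * limitDensity γ x =
      (Real.Gamma γ / γ ^ γ) ^ (1 / (γ + 1)) := by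
  have ha := rate_pos hγ
  have hG := Real.Gamma_pos_of_pos hγ
  have h1 : ∫ x in Set.Ioi 0, x⁻¹ * limitDensity γ x =
      (1 / Real.Gamma (γ + 1) ^ (1 / (γ + 1))) ^ γ * Real.Gamma γ := by
    rw [← Real.integral_rpow_mul_exp_neg_mul_Ioi hγ ha]
    refine setIntegral_congr_fun measurableSet_Ioi fun x (hx : 0 < x) => ?_
    simp only [limitDensity]
    rw [Real.rpow_sub_one hx.ne', neg_mul]
    ring
  have hγ1 : γ + 1 ≠ 0 := by linarith
  rw [h1, one_div (Real.Gamma (γ + 1) ^ (1 / (γ + 1)))]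
  set a := Real.Gamma (γ + 1) ^ (1 / (γ + 1)) with hadef
  have h2 : ((a⁻¹) ^ γ * Real.Gamma γ) ^ (γ + 1) = Real.Gamma γ / γ ^ γ := by
    rw [Real.mul_rpow (by positivity) hG.le, ← Real.rpow_mul (by positivity), mul_comm γ (γ + 1),
      Real.rpow_mul (by positivity), Real.inv_rpow ha.le, rate_rpow hγ, Real.Gamma_add_one hγ.ne',
      Real.inv_rpow (by positivity), Real.mul_rpow hγ.le hG.le, Real.rpow_add_one hG.ne']
    field_simp
  rw [← h2, ← Real.rpow_mul (by positivity), mul_one_div_cancel hγ1, Real.rpow_one]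

theorem integrable_inv_mul_limitDensity {γ : ℝ} (hγ : 0 < γ) :
    IntegrableOn (fun x => x⁻¹ * limitDensity γ x) (Set.Ioi 0) := by
  by_contra h
  have h1 := integral_inv_mul_limitDensity hγ
  rw [integral_undef h] at h1
  have h2 := Real.Gamma_pos_of_pos hγ
  have : 0 < (Real.Gamma γ / γ ^ γ) ^ (1 / (γ + 1)) := by positivity
  exact this.ne h1

/-- Telescoping bound: `θ_j / j` is at most a constant times `θ_j - θ_{j-1}`. -/
theorem sum_gammaCoeff_div_le {γ : ℝ} (hγ : 0 < γ) (J : ℕ) :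
    ∑ j ∈ Finset.Icc 1 J, gammaCoeff γ j / j ≤ (γ + 1) / γ * gammaCoeff γ J := by
  induction J with
  | zero =>
    have := gammaCoeff_pos hγ 0
    simp only [Finset.Icc_eq_empty_of_lt zero_lt_one, Finset.sum_empty]
    positivity
  | succ J ih =>
    rw [Finset.sum_Icc_succ_top (by omega)]
    have h0 := gammaCoeff_pos hγ J
    have h1 := gammaCoeff_pos hγ (J + 1)
    have h2 := gammaCoeff_succ hγ J
    have hJ : (0 : ℝ) < J + 1 := by positivity
    have h3 : gammaCoeff γ (J + 1) / ((J + 1 : ℕ) : ℝ) ≤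
        (γ + 1) / γ * (gammaCoeff γ (J + 1) - gammaCoeff γ J) := by
      have e : gammaCoeff γ (J + 1) = (γ + J + 1) * gammaCoeff γ J / (J + 1) := by
        rw [eq_div_iff hJ.ne', h2]
      have e2 : gammaCoeff γ (J + 1) - gammaCoeff γ J = γ * gammaCoeff γ J / (J + 1) := by
        rw [e]
        field_simp
        ring
      have e3 : (γ + 1) / γ * (γ * gammaCoeff γ J / (J + 1)) =
          (γ + 1) * gammaCoeff γ J / (J + 1) := by
        field_simp
      rw [e2, e3, e]
      push_cast
      rw [div_div, div_le_div_iff₀ (by positivity) hJ]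
      have hJ0 : (0 : ℝ) ≤ J := J.cast_nonneg
      have h4 : γ + J + 1 ≤ (γ + 1) * (J + 1) := by nlinarith
      have h5 := mul_le_mul_of_nonneg_right h4 (mul_pos h0 hJ).le
      linarith
    linarith

theorem firstCycleMass_le {γ : ℝ} (hγ : 0 < γ) {θ : ℕ → ℝ}
    (hθ : ∀ n, 1 ≤ n → θ n = gammaCoeff γ n) {n : ℕ} (hn : 1 ≤ n) (j : ℕ) :
    firstCycleMass θ n j ≤ gammaCoeff γ j / n := by
  have hθpos : ∀ j, 1 ≤ j → 0 < θ j := fun j hj => hθ j hj ▸ gammaCoeff_pos hγ j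
  have hn' : (0 : ℝ) < n := by exact_mod_cast hn
  have hg := gammaCoeff_pos hγ j
  rw [firstCycleMass]
  split_ifs with hj
  · have hh := partitionFunction_pos hθpos n
    have hm := monotone_of_recursion (one_le_gammaCoeff hγ) (partitionFunction_pos hθpos 0).le
      (recursion_of_eq_gammaCoeff hθ) (Nat.sub_le n j)
    rw [hθ j hj.1, div_le_div_iff₀ (by positivity) hn']
    calc gammaCoeff γ j * partitionFunction θ (n - j) * n
        ≤ gammaCoeff γ j * partitionFunction θ n * n := by gcongr
      _ = _ := by ring
  · positivity

/-- The contribution of short cycles to the expected number of cycles is small for small `ε`,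
uniformly in large `n`. -/
theorem eventually_sum_short_le {γ : ℝ} (hγ : 0 < γ) {θ : ℕ → ℝ}
    (hθ : ∀ n, 1 ≤ n → θ n = gammaCoeff γ n) {ε : ℝ} (hε : 0 < ε) :
    ∀ᶠ n : ℕ in atTop, ∑ j ∈ Finset.Icc 1 ⌊ε * cycleScale γ n⌋₊,
      (j / cycleScale γ n)⁻¹ * firstCycleMass θ n j ≤ (γ + 1) / γ * 2 * ε ^ γ := by
  have h1 : ∀ᶠ J : ℕ in atTop, gammaCoeff γ J ≤ 2 * (J : ℝ) ^ γ := by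
    have h2 : Tendsto (gammaCoeff γ / fun j : ℕ => (j : ℝ) ^ γ) atTop (𝓝 1) := by
      refine (isEquivalent_iff_tendsto_one ?_).1 (gammaCoeff_isEquivalent hγ)
      filter_upwards [eventually_gt_atTop 0] with n hn
      have : (0 : ℝ) < n := by exact_mod_cast hn
      positivity
    filter_upwards [h2.eventually (ge_mem_nhds one_lt_two), eventually_gt_atTop 0] with J hJ hJ0
    have : (0 : ℝ) < J := by exact_mod_cast hJ0
    simp only [Pi.div_apply] at hJ
    rwa [div_le_iff₀ (by positivity)] at hJ
  have h3 : Tendsto (fun n : ℕ => ⌊ε * cycleScale γ n⌋₊) atTop atTop :=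
    tendsto_nat_floor_atTop.comp ((tendsto_cycleScale hγ).const_mul_atTop hε)
  filter_upwards [h3.eventually h1, eventually_ge_atTop 1] with n hn hn1
  have hN := cycleScale_pos γ hn1
  have hn' : (0 : ℝ) < n := by exact_mod_cast hn1
  set J := ⌊ε * cycleScale γ n⌋₊ with hJ
  have hJle : (J : ℝ) ≤ ε * cycleScale γ n := Nat.floor_le (by positivity)
  calc ∑ j ∈ Finset.Icc 1 J, (j / cycleScale γ n)⁻¹ * firstCycleMass θ n j
      ≤ ∑ j ∈ Finset.Icc 1 J, cycleScale γ n / n * (gammaCoeff γ j / j) := by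
        refine Finset.sum_le_sum fun j hj => ?_
        have hj' : (0 : ℝ) < j := by exact_mod_cast (Finset.mem_Icc.1 hj).1
        refine (mul_le_mul_of_nonneg_left (firstCycleMass_le hγ hθ hn1 j)
          (by positivity)).trans_eq ?_
        field_simp
    _ ≤ cycleScale γ n / n * ((γ + 1) / γ * (2 * (ε * cycleScale γ n) ^ γ)) := by
        rw [← Finset.mul_sum]
        have := (sum_gammaCoeff_div_le hγ J)
        have h4 : (J : ℝ) ^ γ ≤ (ε * cycleScale γ n) ^ γ := by gcongr
        have h5 : gammaCoeff γ J ≤ 2 * (ε * cycleScale γ n) ^ γ := by linarith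
        refine mul_le_mul_of_nonneg_left (this.trans ?_) (by positivity)
        gcongr
    _ = (γ + 1) / γ * 2 * ε ^ γ := by
        rw [Real.mul_rpow hε.le hN.le, cycleScale_rpow' hγ hn1]
        field_simp

/-- The limit of the expected inverse of the rescaled first cycle length. The unbounded test
function `x⁻¹` is replaced by `(max x ε)⁻¹`, and the difference only involves the cycles of length
at most `ε n ^ (1 / (γ + 1))`. -/
theorem tendsto_sum_inv_firstCycleMass {γ : ℝ} (hγ : 0 < γ) {θ : ℕ → ℝ}
    (hθ : ∀ n, 1 ≤ n → θ n = gammaCoeff γ n) :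
    Tendsto (fun n => ∑ j ∈ Finset.Icc 1 n, (j / cycleScale γ n)⁻¹ * firstCycleMass θ n j) atTop
      (𝓝 (∫ x in Set.Ioi 0, x⁻¹ * limitDensity γ x)) := by
  have hθpos : ∀ j, 1 ≤ j → 0 < θ j := fun j hj => hθ j hj ▸ gammaCoeff_pos hγ j
  have htrunc : Tendsto (fun ε => ∫ x in Set.Ioi 0, (max x ε)⁻¹ * limitDensity γ x) (𝓝[>] 0)
      (𝓝 (∫ x in Set.Ioi 0, x⁻¹ * limitDensity γ x)) := by
    refine tendsto_integral_filter_of_dominated_convergence (fun x => x⁻¹ * limitDensity γ x)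
      ?_ ?_ (integrable_inv_mul_limitDensity hγ) ?_
    · filter_upwards with ε
      exact (by fun_prop : Measurable fun x : ℝ => (max x ε)⁻¹).aestronglyMeasurable.mul
        (integrable_limitDensity hγ).aestronglyMeasurable
    · filter_upwards [self_mem_nhdsWithin] with ε (hε : 0 < ε)
      filter_upwards [ae_restrict_mem measurableSet_Ioi] with x (hx : 0 < x)
      have h1 := limitDensity_nonneg γ hx.le
      have h2 : 0 < max x ε := lt_max_of_lt_left hx
      rw [Real.norm_of_nonneg (by positivity)]
      gcongr
      exact le_max_left _ _
    · filter_upwards [ae_restrict_mem measurableSet_Ioi] with x (hx : 0 < x)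
      refine (tendsto_const_nhds (x := x⁻¹ * limitDensity γ x)).congr' ?_
      filter_upwards [mem_nhdsWithin_of_mem_nhds (gt_mem_nhds hx)] with ε hε
      rw [max_eq_left (le_of_lt hε)]
  have hsmall : Tendsto (fun ε : ℝ => (γ + 1) / γ * 2 * ε ^ γ) (𝓝[>] 0) (𝓝 0) := by
    have h1 : Tendsto (fun ε : ℝ => (γ + 1) / γ * 2 * ε ^ γ) (𝓝 0) (𝓝 ((γ + 1) / γ * 2 * 0 ^ γ)) :=
      ((Real.continuousAt_rpow_const 0 γ (Or.inr hγ.le)).tendsto).const_mul _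
    rw [Real.zero_rpow hγ.ne', mul_zero] at h1
    exact h1.mono_left nhdsWithin_le_nhds
  rw [Metric.tendsto_atTop']
  intro δ hδ
  have hδ3 : 0 < δ / 3 := by linarith
  obtain ⟨ε, ⟨h1, h2⟩, hε⟩ := (((Metric.tendsto_nhds.1 htrunc _ hδ3).and
    (hsmall.eventually (gt_mem_nhds hδ3))).and self_mem_nhdsWithin).exists
  have hε : 0 < ε := hε
  have h3 := tendsto_sum_firstCycleMass hγ hθ (φ := fun x => (max x ε)⁻¹) (M := ε⁻¹) (fun x => by
      have h4 : 0 < max x ε := lt_max_of_lt_right hε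
      rw [abs_of_nonneg (by positivity)]
      gcongr
      exact le_max_right _ _) (Eventually.of_forall fun x => by
        have h4 : 0 < max x ε := lt_max_of_lt_right hε
        exact ContinuousAt.inv₀ (by fun_prop) h4.ne')
  obtain ⟨n0, hn0⟩ := eventually_atTop.1 (((Metric.tendsto_nhds.1 h3 _ hδ3).and
    (eventually_sum_short_le hγ hθ hε)).and (eventually_ge_atTop 1))
  refine ⟨n0, fun n hn => ?_⟩
  obtain ⟨⟨h5, h6⟩, h7⟩ := hn0 n hn.le
  have hN := cycleScale_pos γ h7
  set J := ⌊ε * cycleScale γ n⌋₊ with hJ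
  have hterm : ∀ j ∈ Finset.Icc 1 n,
      0 ≤ (j / cycleScale γ n)⁻¹ * firstCycleMass θ n j := fun j _ =>
    mul_nonneg (by positivity) (firstCycleMass_nonneg hθpos n j)
  have hlow : ∑ j ∈ Finset.Icc 1 n, (max (j / cycleScale γ n) ε)⁻¹ * firstCycleMass θ n j ≤
      ∑ j ∈ Finset.Icc 1 n, (j / cycleScale γ n)⁻¹ * firstCycleMass θ n j := by
    refine Finset.sum_le_sum fun j hj => ?_
    have hj' : (0 : ℝ) < j := by exact_mod_cast (Finset.mem_Icc.1 hj).1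
    have := firstCycleMass_nonneg hθpos n j
    gcongr
    exact le_max_left _ _
  have hup : ∑ j ∈ Finset.Icc 1 n, (j / cycleScale γ n)⁻¹ * firstCycleMass θ n j ≤
      ∑ j ∈ Finset.Icc 1 n, (max (j / cycleScale γ n) ε)⁻¹ * firstCycleMass θ n j +
      ∑ j ∈ Finset.Icc 1 J, (j / cycleScale γ n)⁻¹ * firstCycleMass θ n j := by
    have h8 : ∑ j ∈ (Finset.Icc 1 n).filter (· ≤ J),
        (j / cycleScale γ n)⁻¹ * firstCycleMass θ n j ≤
        ∑ j ∈ Finset.Icc 1 J, (j / cycleScale γ n)⁻¹ * firstCycleMass θ n j := by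
      refine Finset.sum_le_sum_of_subset_of_nonneg (fun j hj => ?_) fun j _ _ =>
        mul_nonneg (by positivity) (firstCycleMass_nonneg hθpos n j)
      rw [Finset.mem_filter, Finset.mem_Icc] at hj
      exact Finset.mem_Icc.2 ⟨hj.1.1, hj.2⟩
    refine le_trans ?_ (add_le_add_right h8 _)
    rw [Finset.sum_filter, ← Finset.sum_add_distrib]
    refine Finset.sum_le_sum fun j hj => ?_
    have hm := firstCycleMass_nonneg hθpos n j
    split_ifs with hjJ
    · have : 0 ≤ (max (j / cycleScale γ n) ε)⁻¹ * firstCycleMass θ n j :=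
        mul_nonneg (inv_nonneg.2 (hε.le.trans (le_max_right _ _))) hm
      linarith
    · have : ε ≤ j / cycleScale γ n := by
        rw [le_div_iff₀ hN]
        exact ((Nat.floor_lt (by positivity)).1 (not_le.1 hjJ)).le
      rw [max_eq_left this, add_zero]
  rw [Real.dist_eq, abs_lt] at h1 h5 ⊢
  constructor <;> linarith

theorem tendsto_integral_numCycles {γ : ℝ} (hγ : 0 < γ) {θ : ℕ → ℝ}
    (hθ : ∀ n, 1 ≤ n → θ n = gammaCoeff γ n) :
    Tendsto (fun n : ℕ => (n : ℝ) ^ (-γ / (γ + 1)) * ∫ σ, (numCycles σ : ℝ) ∂(permLaw θ n)) atTop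
      (𝓝 ((Real.Gamma γ / γ ^ γ) ^ (1 / (γ + 1)))) := by
  have hθpos : ∀ j, 1 ≤ j → 0 < θ j := fun j hj => hθ j hj ▸ gammaCoeff_pos hγ j
  rw [← integral_inv_mul_limitDensity hγ]
  refine (tendsto_sum_inv_firstCycleMass hγ hθ).congr' ?_
  filter_upwards [eventually_ge_atTop 1] with n hn
  have hn' : (0 : ℝ) < n := by exact_mod_cast hn
  have hpow : (n : ℝ) ^ (-γ / (γ + 1)) * n = cycleScale γ n := by
    rw [← Real.rpow_add_one hn'.ne', cycleScale]
    congr 1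
    have : γ + 1 ≠ 0 := by linarith
    field_simp
    ring
  rw [integral_numCycles hθpos hn, ← mul_assoc, hpow, Finset.mul_sum]
  refine Finset.sum_congr rfl fun j _ => ?_
  rw [inv_div]
  ring

/-! ### The joint law of the cycle counts -/

/-- Inclusion–exclusion for the event that a count equals `r`, in terms of binomial moments. -/
theorem ite_eq_sum_choose (x r K : ℕ) (hK : x < K) :
    (if x = r then (1 : ℝ) else 0) =
      ∑ k ∈ Finset.range K, (-1) ^ k * ((r + k).choose r : ℝ) * (x.choose (r + k) : ℝ) := by
  rcases lt_or_ge x r with h | h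
  · rw [if_neg h.ne, Finset.sum_eq_zero]
    intro k _
    rw [Nat.choose_eq_zero_of_lt (by omega : x < r + k)]
    simp
  · have h1 : ∀ k ∈ Finset.range K,
        (-1 : ℝ) ^ k * ((r + k).choose r : ℝ) * (x.choose (r + k) : ℝ) =
        (x.choose r : ℝ) * ((-1) ^ k * ((x - r).choose k : ℝ)) := fun k _ => by
      rcases lt_or_ge x (r + k) with hk | hk
      · rw [Nat.choose_eq_zero_of_lt hk, Nat.choose_eq_zero_of_lt (by omega : x - r < k)]
        simp
      · have h2 := Nat.choose_mul (n := x) (Nat.le_add_right r k)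
        rw [Nat.add_sub_cancel_left] at h2
        have h3 : (x.choose (r + k) : ℝ) * ((r + k).choose r : ℝ) =
            (x.choose r : ℝ) * ((x - r).choose k : ℝ) := by exact_mod_cast h2
        linear_combination (-1 : ℝ) ^ k * h3
    rw [Finset.sum_congr rfl h1, ← Finset.mul_sum]
    have h4 : ∑ k ∈ Finset.range K, (-1 : ℝ) ^ k * ((x - r).choose k : ℝ) =
        ∑ k ∈ Finset.range (x - r + 1), (-1 : ℝ) ^ k * ((x - r).choose k : ℝ) := by
      symm
      refine Finset.sum_subset (Finset.range_subset_range.2 (by omega)) fun k _ hk => ?_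
      rw [Finset.mem_range, not_lt] at hk
      rw [Nat.choose_eq_zero_of_lt (by omega)]
      simp
    have h5 : ∑ k ∈ Finset.range (x - r + 1), (-1 : ℝ) ^ k * ((x - r).choose k : ℝ) =
        if x - r = 0 then 1 else 0 := by
      exact_mod_cast Int.alternating_sum_range_choose (n := x - r)
    rw [h4, h5]
    by_cases hx : x = r
    · subst hx
      simp
    · rw [if_neg hx, if_neg (by omega), mul_zero]

theorem hasSum_partitionSum_ite (θ : ℕ → ℝ) {j : ℕ} (hj : 1 ≤ j) (r : ℕ) (ψ : Multiset ℕ → ℝ)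
    (hψ : ∀ s, ψ (j ::ₘ s) = ψ s) (n : ℕ) :
    HasSum (fun k : ℕ => (θ j / j) ^ r / (r.factorial : ℝ) *
        ((-(θ j / j)) ^ k / (k.factorial : ℝ)) *
        (if j * (r + k) ≤ n then partitionSum θ (n - j * (r + k)) ψ else 0))
      (partitionSum θ n fun s => (if s.count j = r then 1 else 0) * ψ s) := by
  have h1 : (partitionSum θ n fun s => (if s.count j = r then 1 else 0) * ψ s) =
      ∑ k ∈ Finset.range (n + 1), (θ j / j) ^ r / (r.factorial : ℝ) *
        ((-(θ j / j)) ^ k / (k.factorial : ℝ)) *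
        (if j * (r + k) ≤ n then partitionSum θ (n - j * (r + k)) ψ else 0) := by
    have h2 : (partitionSum θ n fun s => (if s.count j = r then 1 else 0) * ψ s) =
        partitionSum θ n fun s => ∑ k ∈ Finset.range (n + 1),
          ((-1) ^ k * ((r + k).choose r : ℝ)) * ((s.count j).choose (r + k) * ψ s) := by
      refine partitionSum_congr θ fun p => ?_
      have hcount : p.parts.count j ≤ n := by
        have h3 : p.parts.count j ≤ p.parts.card := Multiset.count_le_card _ _
        have h4 : p.parts.card ≤ p.parts.sum := by
          have := Multiset.card_nsmul_le_sum (s := p.parts) (a := 1)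
            (fun x hx => p.parts_pos hx)
          simpa using this
        rw [p.parts_sum] at h4
        omega
      rw [ite_eq_sum_choose _ r (n + 1) (by omega), Finset.sum_mul]
      exact Finset.sum_congr rfl fun k _ => by ring
    rw [h2, partitionSum_finsetSum]
    refine Finset.sum_congr rfl fun k _ => ?_
    rw [partitionSum_const_mul, partitionSum_choose_mul θ hj ψ hψ]
    split_ifs with h
    · have h3 : ((r + k).choose r : ℝ) * r.factorial * k.factorial = (r + k).factorial := by
        have := Nat.choose_mul_factorial_mul_factorial (Nat.le_add_right r k)
        rw [Nat.add_sub_cancel_left] at this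
        exact_mod_cast this
      have hr : (r.factorial : ℝ) ≠ 0 := by positivity
      have hk : (k.factorial : ℝ) ≠ 0 := by positivity
      have hrk : ((r + k).choose r : ℝ) ≠ 0 := by
        have := Nat.choose_pos (Nat.le_add_right r k)
        positivity
      rw [← h3, neg_pow (θ j / j) k, pow_add]
      generalize θ j / (j : ℝ) = b
      field_simp
    · simp
  rw [h1]
  refine hasSum_sum_of_ne_finset_zero fun k hk => ?_
  rw [Finset.mem_range, not_lt] at hk
  rw [if_neg, mul_zero]
  have : 1 * k ≤ j * (r + k) := Nat.mul_le_mul hj (by omega)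
  omega

theorem partitionSum_mono {θ : ℕ → ℝ} (hθ : ∀ j, 1 ≤ j → 0 < θ j) {φ ψ : Multiset ℕ → ℝ}
    (h : ∀ s, φ s ≤ ψ s) (n : ℕ) : partitionSum θ n φ ≤ partitionSum θ n ψ := by
  refine Finset.sum_le_sum fun p _ => mul_le_mul_of_nonneg_left (h _) ?_
  refine Finset.prod_nonneg fun i hi => ?_
  have := hθ i (Finset.mem_Icc.1 hi).1
  positivity

/-- Conditioning on one more cycle count contributes one Poisson factor in the limit. -/
theorem tendsto_partitionSum_ite {γ : ℝ} (hγ : 0 < γ) {θ : ℕ → ℝ}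
    (hθ : ∀ n, 1 ≤ n → θ n = gammaCoeff γ n) {j : ℕ} (hj : 1 ≤ j) (r : ℕ) {ψ : Multiset ℕ → ℝ}
    (hψ : ∀ s, ψ (j ::ₘ s) = ψ s) (hψ0 : ∀ s, 0 ≤ ψ s) (hψ1 : ∀ s, ψ s ≤ 1) {L : ℝ}
    (hL : Tendsto (fun n => partitionSum θ n ψ / partitionFunction θ n) atTop (𝓝 L)) :
    Tendsto (fun n => partitionSum θ n (fun s => (if s.count j = r then 1 else 0) * ψ s) /
      partitionFunction θ n) atTop
      (𝓝 (Real.exp (-(θ j / j)) * (θ j / j) ^ r / (r.factorial : ℝ) * L)) := by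
  have hθpos : ∀ j, 1 ≤ j → 0 < θ j := fun j hj => hθ j hj ▸ gammaCoeff_pos hγ j
  have hh := partitionFunction_pos hθpos
  have hmono := monotone_of_recursion (one_le_gammaCoeff hγ) (hh 0).le
    (recursion_of_eq_gammaCoeff hθ)
  have hb : 0 ≤ θ j / j := by
    have := hθpos j hj
    positivity
  set b := θ j / j with hbdef
  have hu0 : ∀ n, 0 ≤ partitionSum θ n ψ := fun n => by
    have := partitionSum_mono hθpos hψ0 n
    simpa [partitionSum] using this
  have hu1 : ∀ n, partitionSum θ n ψ ≤ partitionFunction θ n := fun n => by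
    rw [partitionFunction_eq]
    exact partitionSum_mono hθpos hψ1 n
  have hsum : HasSum (fun k : ℕ => b ^ r / (r.factorial : ℝ) *
      ((-b) ^ k / (k.factorial : ℝ)) * L) (Real.exp (-b) * b ^ r / (r.factorial : ℝ) * L) := by
    have h1 := NormedSpace.expSeries_div_hasSum_exp (-b)
    rw [← Real.exp_eq_exp_ℝ] at h1
    have h2 := (h1.mul_left (b ^ r / (r.factorial : ℝ))).mul_right L
    rwa [mul_comm _ (Real.exp (-b)), ← mul_div_assoc] at h2
  rw [← hsum.tsum_eq]
  have hterm : ∀ n, partitionSum θ n (fun s => (if s.count j = r then 1 else 0) * ψ s) /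
      partitionFunction θ n = ∑' k : ℕ, b ^ r / (r.factorial : ℝ) *
        ((-b) ^ k / (k.factorial : ℝ)) * ((if j * (r + k) ≤ n then
          partitionSum θ (n - j * (r + k)) ψ else 0) / partitionFunction θ n) := fun n => by
    have h1 := (hasSum_partitionSum_ite θ hj r ψ hψ n).div_const (partitionFunction θ n)
    rw [← h1.tsum_eq]
    exact tsum_congr fun k => by rw [mul_div_assoc]
  simp only [hterm]
  refine tendsto_tsum_of_dominated_convergence
    (bound := fun k : ℕ => b ^ r / (r.factorial : ℝ) * (b ^ k / (k.factorial : ℝ)))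
    ((Real.summable_pow_div_factorial b).mul_left _) (fun k => ?_) ?_
  · refine Tendsto.const_mul _ ?_
    have h1 := tendsto_ratio_one hγ hh (recursion_of_eq_gammaCoeff hθ) (j * (r + k))
    have h2 := (hL.comp (tendsto_sub_atTop_nat (j * (r + k)))).mul h1
    rw [mul_one] at h2
    refine h2.congr' ?_
    filter_upwards [eventually_ge_atTop (j * (r + k))] with n hn
    have h3 := (hh (n - j * (r + k))).ne'
    have h4 := (hh n).ne'
    rw [if_pos hn]
    simp only [Function.comp]
    field_simp
  · filter_upwards with n k
    have h1 : |(if j * (r + k) ≤ n then partitionSum θ (n - j * (r + k)) ψ else 0) /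
        partitionFunction θ n| ≤ 1 := by
      rw [abs_div, abs_of_pos (hh n), div_le_one (hh n)]
      split_ifs
      · rw [abs_of_nonneg (hu0 _)]
        exact (hu1 _).trans (hmono (Nat.sub_le _ _))
      · simpa using (hh n).le
    rw [norm_mul, norm_mul, norm_div, norm_div, norm_pow, norm_pow, norm_neg,
      Real.norm_of_nonneg hb, Real.norm_of_nonneg (by positivity : (0 : ℝ) ≤ r.factorial),
      Real.norm_of_nonneg (by positivity : (0 : ℝ) ≤ k.factorial), Real.norm_eq_abs]
    exact mul_le_of_le_one_right (by positivity) h1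

/-- The indicator of the event that the first `m` counts have the values `c 0, …, c (m - 1)`. -/
def countIndicator (c : ℕ → ℕ) (m : ℕ) (s : Multiset ℕ) : ℝ :=
  if ∀ i < m, s.count (i + 1) = c i then 1 else 0

theorem countIndicator_succ (c : ℕ → ℕ) (m : ℕ) (s : Multiset ℕ) :
    countIndicator c (m + 1) s =
      (if s.count (m + 1) = c m then 1 else 0) * countIndicator c m s := by
  simp only [countIndicator, Nat.forall_lt_succ_right]
  by_cases h1 : s.count (m + 1) = c m <;> by_cases h2 : ∀ i < m, s.count (i + 1) = c i <;>
    simp [h1, h2]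

theorem tendsto_partitionSum_countIndicator {γ : ℝ} (hγ : 0 < γ) {θ : ℕ → ℝ}
    (hθ : ∀ n, 1 ≤ n → θ n = gammaCoeff γ n) (c : ℕ → ℕ) (m : ℕ) :
    Tendsto (fun n => partitionSum θ n (countIndicator c m) / partitionFunction θ n) atTop
      (𝓝 (∏ i ∈ Finset.range m, (Real.exp (-(θ (i + 1) / (i + 1 : ℕ))) *
        (θ (i + 1) / (i + 1 : ℕ)) ^ c i / ((c i).factorial : ℝ)))) := by
  have hθpos : ∀ j, 1 ≤ j → 0 < θ j := fun j hj => hθ j hj ▸ gammaCoeff_pos hγ j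
  induction m with
  | zero =>
    refine tendsto_const_nhds.congr fun n => ?_
    have h1 : countIndicator c 0 = fun _ => 1 := by
      funext s
      simp [countIndicator]
    rw [h1, ← partitionFunction_eq, div_self (partitionFunction_pos hθpos n).ne']
    simp
  | succ m ih =>
    have h1 : countIndicator c (m + 1) = fun s =>
        (if s.count (m + 1) = c m then 1 else 0) * countIndicator c m s :=
      funext (countIndicator_succ c m)
    rw [h1, Finset.prod_range_succ, mul_comm]
    refine tendsto_partitionSum_ite hγ hθ (by omega) (c m) (fun s => ?_) (fun s => ?_)
      (fun s => ?_) ih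
    · have h2 : ∀ i < m, ((m + 1) ::ₘ s).count (i + 1) = s.count (i + 1) := fun i hi =>
        Multiset.count_cons_of_ne (by omega) _
      simp +contextual only [countIndicator, h2]
    · unfold countIndicator
      split_ifs <;> simp
    · unfold countIndicator
      split_ifs <;> simp

theorem isPiSystem_prefixCylinders :
    IsPiSystem {A : Set (ℕ → ℕ) | ∃ (m : ℕ) (c : ℕ → ℕ), A = {r | ∀ i < m, r i = c i}} := by
  rintro _ ⟨m, c, rfl⟩ _ ⟨m', c', rfl⟩ ⟨x, hx, hx'⟩
  refine ⟨max m m', x, ?_⟩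
  ext r
  simp only [Set.mem_inter_iff, Set.mem_ofPred_eq] at hx hx' ⊢
  constructor
  · rintro ⟨h1, h2⟩ i hi
    rcases lt_max_iff.1 hi with hi | hi
    · rw [h1 i hi, hx i hi]
    · rw [h2 i hi, hx' i hi]
  · intro h
    exact ⟨fun i hi => (h i (lt_max_of_lt_left hi)).trans (hx i hi),
      fun i hi => (h i (lt_max_of_lt_right hi)).trans (hx' i hi)⟩

theorem prefixCylinder_eq_pi (m : ℕ) (c : ℕ → ℕ) :
    {r : ℕ → ℕ | ∀ i < m, r i = c i} = Set.pi (Finset.range m : Set ℕ) fun i => {c i} := by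
  ext r
  simp

theorem tendstoInDistribution_cycleCount {γ : ℝ} (hγ : 0 < γ) {θ : ℕ → ℝ}
    (hθ : ∀ n, 1 ≤ n → θ n = gammaCoeff γ n) [∀ n, IsProbabilityMeasure (permLaw θ n)] :
    TendstoInDistribution
      (fun (n : ℕ) (σ : Equiv.Perm (Fin n)) (j : ℕ) => cycleCount (j + 1) σ)
      atTop (fun r : ℕ → ℕ => r) (fun n => permLaw θ n)
      (Measure.infinitePi fun j : ℕ =>
        poissonMeasure (θ (j + 1) / ((j : ℝ) + 1)).toNNReal) where
  forall_aemeasurable n := (measurable_perm _).aemeasurable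
  aemeasurable_limit := aemeasurable_id
  tendsto := by
    have hθpos : ∀ j, 1 ≤ j → 0 < θ j := fun j hj => hθ j hj ▸ gammaCoeff_pos hγ j
    have hmeas : ∀ (m : ℕ) (c : ℕ → ℕ), MeasurableSet {r : ℕ → ℕ | ∀ i < m, r i = c i} :=
      fun m c => by
        rw [prefixCylinder_eq_pi]
        exact MeasurableSet.pi (Finset.countable_toSet _) fun i _ => measurableSet_singleton _
    refine isPiSystem_prefixCylinders.tendsto_probabilityMeasure_of_tendsto_of_mem ?_ ?_ ?_
    · rintro _ ⟨m, c, rfl⟩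
      exact hmeas m c
    · -- a basic open set only constrains finitely many coordinates, hence contains a cylinder
      intro u hu x hx
      obtain ⟨I, v, hv, hvu⟩ := isOpen_pi_iff.1 hu x hx
      refine ⟨{r | ∀ i < I.sup id + 1, r i = x i}, ⟨_, _, rfl⟩, ?_, fun r hr => hvu fun i hi => ?_⟩
      · rw [prefixCylinder_eq_pi]
        exact set_pi_mem_nhds (Finset.finite_toSet _) fun i _ => mem_nhds_discrete.2 rfl
      · have : i ≤ I.sup id := Finset.le_sup (f := id) hi
        rw [hr i (by omega)]
        exact (hv i hi).2
    · rintro _ ⟨m, c, rfl⟩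
      rw [← NNReal.tendsto_coe]
      have h := tendsto_partitionSum_countIndicator hγ hθ c m
      have e1 : ∀ n, partitionSum θ n (countIndicator c m) / partitionFunction θ n =
          (((permLaw θ n).map fun (σ : Equiv.Perm (Fin n)) (j : ℕ) =>
            cycleCount (j + 1) σ).real {r | ∀ i < m, r i = c i}) := fun n => by
        rw [map_measureReal_apply (measurable_perm _) (hmeas m c), ← integral_permLaw_parts hθpos,
          ← integral_indicator_one (measurable_perm _ (hmeas m c))]
        refine integral_congr_ae (Eventually.of_forall fun σ => ?_)
        have hmem : σ ∈ (fun (σ : Equiv.Perm (Fin n)) (j : ℕ) => cycleCount (j + 1) σ) ⁻¹'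
          {r | ∀ i < m, r i = c i} ↔ ∀ i < m, σ.partition.parts.count (i + 1) = c i := Iff.rfl
        simp only [countIndicator]
        by_cases hσ : ∀ i < m, σ.partition.parts.count (i + 1) = c i
        · rw [if_pos hσ, Set.indicator_of_mem (hmem.2 hσ), Pi.one_apply]
        · rw [if_neg hσ, Set.indicator_of_notMem (mt hmem.1 hσ)]
      have e2 : ∏ i ∈ Finset.range m, (Real.exp (-(θ (i + 1) / (i + 1 : ℕ))) *
          (θ (i + 1) / (i + 1 : ℕ)) ^ c i / ((c i).factorial : ℝ)) =
          ((Measure.infinitePi fun j : ℕ =>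
            poissonMeasure (θ (j + 1) / ((j : ℝ) + 1)).toNNReal).map fun r => r).real
              {r | ∀ i < m, r i = c i} := by
        rw [Measure.map_id', prefixCylinder_eq_pi, measureReal_def,
          Measure.infinitePi_pi _ fun i _ => measurableSet_singleton _, ENNReal.toReal_prod]
        refine Finset.prod_congr rfl fun i _ => ?_
        have h1 := hθpos (i + 1) (by omega)
        rw [← measureReal_def, poissonMeasure_real_singleton, Real.coe_toNNReal _ (by positivity)]
        push_cast
        rfl
      rw [e2] at h
      simp only [e1] at h
      exact h

end WeightedPerm

theorem mainTheorem2 (γ : ℝ) (hγ : 0 < γ) :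
    -- the parameters with this generating function
    (∀ θ : ℕ → ℝ, WeightedPerm.HasAlgebraicGenFun γ θ ↔
      ∀ n : ℕ, 1 ≤ n → θ n = Real.Gamma (γ + n + 1) / (n.factorial : ℝ)) ∧
    ∀ θ : ℕ → ℝ, WeightedPerm.HasAlgebraicGenFun γ θ →
      (θ ~[atTop] fun n : ℕ => (n : ℝ) ^ γ) ∧
      ∃ _ : ∀ n : ℕ, IsProbabilityMeasure (WeightedPerm.permLaw θ n),
        -- (a) weak convergence of the rescaled typical cycle length to a Gamma law
        (∃ _ : IsProbabilityMeasure
            (gammaMeasure (γ + 1) (Real.Gamma (γ + 1) ^ (1 / (γ + 1)))),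
          TendstoInDistribution
            (fun (n : ℕ) (σ : Equiv.Perm (Fin n)) =>
              (WeightedPerm.firstCycleLength σ : ℝ) / (n : ℝ) ^ (1 / (1 + γ)))
            atTop (fun x : ℝ => x) (fun n => WeightedPerm.permLaw θ n)
            (gammaMeasure (γ + 1) (Real.Gamma (γ + 1) ^ (1 / (γ + 1))))) ∧
        (∀ s : ℝ, 0 ≤ s →
          Tendsto
            (fun n : ℕ => (WeightedPerm.permLaw θ n).real
              {σ | (WeightedPerm.firstCycleLength σ : ℝ) / (n : ℝ) ^ (1 / (1 + γ)) < s})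
            atTop
            (𝓝 (∫ x in (0 : ℝ)..s,
              x ^ γ * Real.exp (-(Real.Gamma (γ + 1) ^ (1 / (γ + 1))) * x)))) ∧
        -- (b) the expected number of cycles
        Tendsto
          (fun n : ℕ => (n : ℝ) ^ (-γ / (γ + 1)) *
            ∫ σ, (WeightedPerm.numCycles σ : ℝ) ∂(WeightedPerm.permLaw θ n))
          atTop (𝓝 ((Real.Gamma γ / γ ^ γ) ^ (1 / (γ + 1)))) ∧
        -- (c) joint weak convergence of `(R_1, R_2, …)` to independent Poisson variables
        TendstoInDistribution
          (fun (n : ℕ) (σ : Equiv.Perm (Fin n)) (j : ℕ) =>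
            WeightedPerm.cycleCount (j + 1) σ)
          atTop (fun r : ℕ → ℕ => r) (fun n => WeightedPerm.permLaw θ n)
          (Measure.infinitePi fun j : ℕ =>
            poissonMeasure (θ (j + 1) / ((j : ℝ) + 1)).toNNReal) := by
  refine ⟨WeightedPerm.hasAlgebraicGenFun_iff hγ, fun θ hgen => ?_⟩
  have hθ := (WeightedPerm.hasAlgebraicGenFun_iff hγ θ).1 hgen
  have hθpos : ∀ j, 1 ≤ j → 0 < θ j := fun j hj => hθ j hj ▸ WeightedPerm.gammaCoeff_pos hγ j
  have hscale : ∀ n : ℕ, (n : ℝ) ^ (1 / (1 + γ)) = WeightedPerm.cycleScale γ n := fun n => by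
    rw [add_comm, WeightedPerm.cycleScale]
  have hprob := WeightedPerm.isProbabilityMeasure_permLaw hθpos
  have hgamma := isProbabilityMeasure_gammaMeasure (show 0 < γ + 1 by linarith)
    (WeightedPerm.rate_pos hγ)
  simp only [hscale]
  refine ⟨?_, hprob, ⟨hgamma, WeightedPerm.tendstoInDistribution_firstCycleLength hγ hθ⟩,
    fun s hs => WeightedPerm.tendsto_firstCycleLength_lt hγ hθ hs,
    WeightedPerm.tendsto_integral_numCycles hγ hθ,
    WeightedPerm.tendstoInDistribution_cycleCount hγ hθ⟩
  refine (WeightedPerm.gammaCoeff_isEquivalent hγ).congr_left ?_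
  filter_upwards [eventually_ge_atTop 1] with n hn using (hθ n hn).symm
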